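/- Let $X$ be a filtered space of formal dimension $n$, i.e. a non-empty topological space with closed subsets $\emptyset=X_{-1}\subseteq X_0\subseteq\dots\subseteq X_{n-1}\subsetneq X_n=X$. Its strata are the connected components of the differences $X_i\setminus X_{i-1}$; a stratum $S\subseteq X_i\setminus X_{i-1}$ has codimension $\operatorname{codim}S=n-i$, and is regular if $i=n$ and singular otherwise. Assume that the stratification is locally finite: every point of $X$ has a neighbourhood that meets only finitely many strata. Let $\overline p$ be any perversity on $X$, i.e. any map from the set of strata to $\mathbb Z\cup\{\pm\infty\}$ with value $0$ on the regular strata. A subset of a Euclidean simplex has dimension $\le\ell$ if it is contained in a (compact) polyhedron of dimension $\le\ell$ (with $\dim\emptyset=-\infty$). A singular simplex $\sigma\colon\Delta^m\to X$ is $\overline p$-allowable if $\dim\sigma^{-1}(S)\le m-\operatorname{codim}S+\overline p(S)$ for every singular stratum $S$, and $\overline p$-full if $\sigma$ and all its iterated faces are $\overline p$-allowable. The $\overline p$-full simplices form a simplicial subset $\mathscr G_{\overline p}X$ of the singular simplicial set of $X$. Let $C_*(\mathscr G_{\overline p}X;\mathbb Z)$ be its chain complex, and let $C_*^{\overline p}(X;\mathbb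 Z)$ be the complex of those singular chains $\xi$ for which both $\xi$ and $\partial\xi$ are linear combinations of $\overline p$-allowable simplices; write $H_*^{\overline p}(X;\mathbb Z)$ for its homology. Then the inclusion of chain complexes $C_*(\mathscr G_{\overline p}X;\mathbb Z)\to C_*^{\overline p}(X;\mathbb Z)$ induces isomorphisms $$H_0(\mathscr G_{\overline p}X;\mathbb Z)\xrightarrow{\ \cong\ }H_0^{\overline p}(X;\mathbb Z)\qquad\text{and}\qquad H_1(\mathscr G_{\overline p}X;\mathbb Z)\xrightarrow{\ \cong\ }H_1^{\overline p}(X;\mathbb Z).$$ -/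

import Mathlib

open CategoryTheory Opposite Topology
open scoped Simplicial

universe u

/-! ### Filtered spaces, strata, perversities -/

/-- A filtered space of formal dimension `n`: a filtration
`∅ = X₋₁ ⊆ X₀ ⊆ ⋯ ⊆ Xₙ₋₁ ⊊ Xₙ = X` of a non-empty space by closed subsets. -/
structure FilteredSpace (X : Type u) [TopologicalSpace X] (n : ℕ) where
  skel : Fin (n + 1) → Set X
  isClosed_skel : ∀ i, IsClosed (skel i)
  monotone_skel : Monotone skel
  skel_last : skel (Fin.last n) = Set.univ
  skel_ne_univ : ∀ i, i < Fin.last n → skel i ≠ Set.univ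
  nonempty : Nonempty X

namespace FilteredSpace

variable {X : Type u} [TopologicalSpace X] {n : ℕ}

/-- The difference `Xᵢ \ Xᵢ₋₁` of two successive skeleta (with `X₋₁ = ∅`). -/
def piece (F : FilteredSpace X n) (i : Fin (n + 1)) : Set X :=
  {x | x ∈ F.skel i ∧ ∀ j : Fin (n + 1), j < i → x ∉ F.skel j}

/-- A stratum is a connected component of some `Xᵢ \ Xᵢ₋₁`. -/
def Stratum (F : FilteredSpace X n) : Type u :=
  Σ i : Fin (n + 1), ConnectedComponents (F.piece i)

namespace Stratum

variable {F : FilteredSpace X n}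

/-- The subset of `X` underlying a stratum. -/
def carrier (S : F.Stratum) : Set X :=
  {x | ∃ h : x ∈ F.piece S.1, ConnectedComponents.mk (⟨x, h⟩ : F.piece S.1) = S.2}

/-- The formal codimension `n - i` of a stratum in `Xᵢ \ Xᵢ₋₁`. -/
def codim (S : F.Stratum) : ℤ := (n : ℤ) - ((S.1 : ℕ) : ℤ)

/-- Regular strata are the components of `X \ Xₙ₋₁`. -/
def IsRegular (S : F.Stratum) : Prop := S.1 = Fin.last n

/-- Singular strata are the strata contained in `Xₙ₋₁`. -/
def IsSingular (S : F.Stratum) : Prop := ¬ S.IsRegular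

end Stratum

/-- Every point has a neighbourhood that meets only finitely many strata. -/
def LocallyFiniteStratification (F : FilteredSpace X n) : Prop :=
  ∀ x : X, ∃ U ∈ 𝓝 x, Set.Finite {S | (Stratum.carrier (F := F) S ∩ U).Nonempty}

end FilteredSpace

/-- The extended integers `ℤ ∪ {±∞}`. -/
abbrev ExtInt : Type := WithBot (WithTop ℤ)

/-- The inclusion of the integers in the extended integers. -/
def ExtInt.ofInt (z : ℤ) : ExtInt := ((z : WithTop ℤ) : WithBot (WithTop ℤ))

/-- A perversity: a map from the strata to `ℤ ∪ {±∞}` with value `0` on the regular strata. -/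
structure Perversity {X : Type u} [TopologicalSpace X] {n : ℕ} (F : FilteredSpace X n) where
  val : F.Stratum → ExtInt
  val_regular : ∀ S : F.Stratum, S.IsRegular → val S = 0

/-! ### Polyhedral dimension -/

/-- The dimension of the convex cell spanned by a finite set of points. -/
noncomputable def cellDim {k : ℕ} (T : Finset (Fin k → ℝ)) : ℤ :=
  (Module.finrank ℝ (vectorSpan ℝ (T : Set (Fin k → ℝ))) : ℤ)

/-- `PolyDimLE A b` says that `A` is included in a polyhedron of dimension at most `b`.
A polyhedron is a finite union of convex cells (convex hulls of non-empty finite sets), and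
its dimension is the largest dimension of these cells, `-∞` for the empty polyhedron. -/
def PolyDimLE {k : ℕ} (A : Set (stdSimplex ℝ (Fin k))) (b : ExtInt) : Prop :=
  ∃ Q : Finset (Finset (Fin k → ℝ)),
    (∀ T ∈ Q, T.Nonempty ∧ ExtInt.ofInt (cellDim T) ≤ b) ∧
    ∀ x ∈ A, ∃ T ∈ Q, (x : Fin k → ℝ) ∈ convexHull ℝ (T : Set (Fin k → ℝ))

/-! ### Allowable and full simplices -/

section Allowable

variable {X : Type u} [TopologicalSpace X] {n : ℕ} {F : FilteredSpace X n}

/-- A map `σ : Δᵐ → X` is `p`-allowable if `dim σ⁻¹(S) ≤ m - codim S + p(S)` for every singular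
stratum `S`. -/
def Perversity.AllowableMap (p : Perversity F) {m : ℕ}
    (σ : C(stdSimplex ℝ (Fin (m + 1)), X)) : Prop :=
  ∀ S : F.Stratum, S.IsSingular →
    PolyDimLE (σ ⁻¹' S.carrier) (ExtInt.ofInt ((m : ℤ) - S.codim) + p.val S)

/-- The `p`-allowable simplices of the singular simplicial set of `X`. -/
def Perversity.Allowable (p : Perversity F) {d : SimplexCategoryᵒᵖ}
    (σ : (TopCat.toSSet.obj (TopCat.of X)).obj d) : Prop :=
  p.AllowableMap (TopCat.toSSetObjEquiv (TopCat.of X) d σ)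

/-- A singular simplex is `p`-full if it and all its iterated faces are `p`-allowable. The
iterated faces are the restrictions along the injective maps `[k] → [m]`. -/
def Perversity.Full (p : Perversity F) {d : SimplexCategoryᵒᵖ}
    (σ : (TopCat.toSSet.obj (TopCat.of X)).obj d) : Prop :=
  ∀ (e : SimplexCategory) (θ : e ⟶ d.unop), Function.Injective θ.toOrderHom →
    p.Allowable ((TopCat.toSSet.obj (TopCat.of X)).map θ.op σ)

end Allowable

/-! ### Full simplices are stable under degeneracies -/

lemma ExtInt.ofInt_add_one (z : ℤ) : ExtInt.ofInt (z + 1) = ExtInt.ofInt z + 1 := rfl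

lemma linearMap_injective_apply {k l : ℕ} (δ : Fin k → Fin l) (hδ : Function.Injective δ)
    (x : Fin k → ℝ) (b : Fin k) : FunOnFinite.linearMap ℝ ℝ δ x (δ b) = x b := by
  rw [FunOnFinite.linearMap_apply_apply]
  have : Finset.univ.filter (fun c => δ c = δ b) = {b} := by
    ext c
    simp [hδ.eq_iff]
  simp [this]

lemma linearMap_apply_of_notMem {k l : ℕ} (δ : Fin k → Fin l) (x : Fin k → ℝ) (a : Fin l)
    (ha : ∀ c, δ c ≠ a) : FunOnFinite.linearMap ℝ ℝ δ x a = 0 := by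
  rw [FunOnFinite.linearMap_apply_apply]
  have : Finset.univ.filter (fun c => δ c = a) = ∅ := by
    ext c
    simp [ha]
  simp [this]

lemma predAbove_eq_iff {m : ℕ} (i : Fin (m + 1)) (c : Fin (m + 2)) :
    i.predAbove c = i ↔ c = i.castSucc ∨ c = i.succ := by
  constructor
  · intro h
    by_contra! hc
    have h1 := Fin.succAbove_predAbove hc.1
    have h2 := Fin.succ_succAbove_predAbove hc.2
    rw [h] at h1 h2
    rw [Fin.succAbove_castSucc_self] at h1
    exact hc.2 h1.symm
  · rintro (rfl | rfl) <;> simp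

lemma degeneracy_lift {m : ℕ} (i : Fin (m + 1)) (y : Fin (m + 2) → ℝ) (hy : ∀ a, 0 ≤ y a) :
    ∃ r s : ℝ, 0 ≤ r ∧ 0 ≤ s ∧ r + s = 1 ∧
      r • FunOnFinite.linearMap ℝ ℝ (i.succ.succAbove)
          (FunOnFinite.linearMap ℝ ℝ (i.predAbove) y) +
        s • FunOnFinite.linearMap ℝ ℝ (i.castSucc.succAbove)
          (FunOnFinite.linearMap ℝ ℝ (i.predAbove) y) = y := by
  set x := FunOnFinite.linearMap ℝ ℝ (i.predAbove : Fin (m + 2) → _) y with hx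
  have hne : i.castSucc ≠ i.succ := (Fin.castSucc_lt_succ).ne
  have hxi : x i = y i.castSucc + y i.succ := by
    rw [hx, FunOnFinite.linearMap_apply_apply]
    have : Finset.univ.filter (fun c => i.predAbove c = i) = {i.castSucc, i.succ} := by
      ext c
      simp [predAbove_eq_iff]
    rw [this, Finset.sum_pair hne]
  have hxa : ∀ a, a ≠ i.castSucc → a ≠ i.succ → x (i.predAbove a) = y a := by
    intro a h1 h2
    rw [hx, FunOnFinite.linearMap_apply_apply]
    have : Finset.univ.filter (fun c => i.predAbove c = i.predAbove a) = {a} := by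
      ext c
      simp only [Finset.mem_filter, Finset.mem_univ, true_and, Finset.mem_singleton]
      refine ⟨fun h => ?_, fun h => by rw [h]⟩
      have hc : c ≠ i.castSucc := by
        rintro rfl
        have : i.predAbove a = i := by rw [← h]; simp
        exact ((predAbove_eq_iff i a).1 this).elim h1 h2
      rw [← Fin.succAbove_predAbove hc, h, Fin.succAbove_predAbove h1]
    simp [this]
  have h0 : ∀ a, a ≠ i.succ →
      FunOnFinite.linearMap ℝ ℝ (i.succ.succAbove) x a = x (i.predAbove a) := by
    intro a ha
    conv_lhs => rw [← Fin.succ_succAbove_predAbove ha]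
    exact linearMap_injective_apply _ Fin.succAbove_right_injective _ _
  have h0' : FunOnFinite.linearMap ℝ ℝ (i.succ.succAbove) x i.succ = 0 :=
    linearMap_apply_of_notMem _ _ _ fun c => Fin.succAbove_ne _ _
  have h1 : ∀ a, a ≠ i.castSucc →
      FunOnFinite.linearMap ℝ ℝ (i.castSucc.succAbove) x a = x (i.predAbove a) := by
    intro a ha
    conv_lhs => rw [← Fin.succAbove_predAbove ha]
    exact linearMap_injective_apply _ Fin.succAbove_right_injective _ _
  have h1' : FunOnFinite.linearMap ℝ ℝ (i.castSucc.succAbove) x i.castSucc = 0 :=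
    linearMap_apply_of_notMem _ _ _ fun c => Fin.succAbove_ne _ _
  have key : ∀ r s : ℝ, r + s = 1 → r * x i = y i.castSucc → s * x i = y i.succ →
      r • FunOnFinite.linearMap ℝ ℝ (i.succ.succAbove) x +
        s • FunOnFinite.linearMap ℝ ℝ (i.castSucc.succAbove) x = y := by
    intro r s hrs hr hs
    funext a
    simp only [Pi.add_apply, Pi.smul_apply, smul_eq_mul]
    by_cases ha : a = i.castSucc
    · subst ha
      rw [h0 _ hne, h1', Fin.predAbove_castSucc_self, hr]
      ring
    by_cases ha' : a = i.succ
    · subst ha'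
      rw [h1 _ hne.symm, h0', Fin.predAbove_succ_self, hs]
      ring
    rw [h0 _ ha', h1 _ ha, hxa a ha ha', ← add_mul, hrs, one_mul]
  have hp := hy i.castSucc
  have hq := hy i.succ
  rcases eq_or_ne (x i) 0 with h | h
  · refine ⟨1, 0, zero_le_one, le_rfl, by norm_num, key 1 0 (by norm_num) ?_ ?_⟩ <;>
      rw [h] <;> rw [hxi] at h <;> linarith
  · have hpos : 0 ≤ x i := by rw [hxi]; positivity
    refine ⟨y i.castSucc / x i, y i.succ / x i, by positivity, by positivity, ?_,
      key _ _ ?_ ?_ ?_⟩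
    · rw [← add_div, ← hxi, div_self h]
    · rw [← add_div, ← hxi, div_self h]
    · field_simp
    · field_simp

lemma degeneracy_comp_face {m : ℕ} (i : Fin (m + 1)) (δ : Fin (m + 1) → Fin (m + 2))
    (hδ : ∀ b, i.predAbove (δ b) = b) (x : Fin (m + 1) → ℝ) :
    FunOnFinite.linearMap ℝ ℝ (i.predAbove) (FunOnFinite.linearMap ℝ ℝ δ x) = x := by
  rw [← LinearMap.comp_apply, ← FunOnFinite.linearMap_comp]
  have : (i.predAbove : Fin (m + 2) → _) ∘ δ = id := funext hδ
  rw [this]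
  simp

lemma finrank_comap_degeneracy {m : ℕ} (i : Fin (m + 1)) (V : Submodule ℝ (Fin (m + 1) → ℝ)) :
    Module.finrank ℝ (V.comap (FunOnFinite.linearMap ℝ ℝ (i.predAbove : Fin (m + 2) → _))) ≤
      Module.finrank ℝ V + 1 := by
  set s := FunOnFinite.linearMap ℝ ℝ (i.predAbove : Fin (m + 2) → Fin (m + 1)) with hs
  have hker : Module.finrank ℝ (LinearMap.ker s) = 1 := by
    have h := LinearMap.finrank_range_add_finrank_ker s
    have hsurj : LinearMap.range s = ⊤ := by
      rw [LinearMap.range_eq_top]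
      intro x
      exact ⟨_, degeneracy_comp_face i i.castSucc.succAbove
        (fun b => Fin.predAbove_succAbove i b) x⟩
    rw [hsurj, finrank_top] at h
    simp only [Module.finrank_fintype_fun_eq_card, Fintype.card_fin] at h
    omega
  have h := LinearMap.finrank_range_add_finrank_ker (s.domRestrict (V.comap s))
  have h1 : Module.finrank ℝ (LinearMap.range (s.domRestrict (V.comap s))) ≤
      Module.finrank ℝ V := by
    apply Submodule.finrank_mono
    rintro _ ⟨z, rfl⟩
    exact z.2
  have h2 : Module.finrank ℝ (LinearMap.ker (s.domRestrict (V.comap s))) ≤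
      Module.finrank ℝ (LinearMap.ker s) := by
    refine LinearMap.finrank_le_finrank_of_injective
      (f := ((V.comap s).subtype.comp (LinearMap.ker (s.domRestrict (V.comap s))).subtype).codRestrict
        (LinearMap.ker s) fun z => z.2) ?_
    intro z w hzw
    have h3 : (z.1.1 : Fin (m + 2) → ℝ) = w.1.1 := congrArg (fun v : LinearMap.ker s => (v : Fin (m + 2) → ℝ)) hzw
    exact Subtype.ext (Subtype.ext h3)
  omega

lemma PolyDimLE.preimage_degeneracy {m : ℕ} (i : Fin (m + 1))
    {A : Set (stdSimplex ℝ (Fin (m + 1)))} {b : ExtInt} (h : PolyDimLE A b) :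
    PolyDimLE (stdSimplex.map (S := ℝ) (i.predAbove) ⁻¹' A) (b + 1) := by
  classical
  obtain ⟨Q, hQ, hA⟩ := h
  set e0 := FunOnFinite.linearMap ℝ ℝ (i.succ.succAbove : Fin (m + 1) → Fin (m + 2)) with he0
  set e1 := FunOnFinite.linearMap ℝ ℝ (i.castSucc.succAbove : Fin (m + 1) → Fin (m + 2)) with he1
  set s := FunOnFinite.linearMap ℝ ℝ (i.predAbove : Fin (m + 2) → Fin (m + 1)) with hs
  have hs0 : ∀ x, s (e0 x) = x := degeneracy_comp_face i _ fun b => by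
    exact Fin.succAbove_right_injective (Fin.succ_succAbove_predAbove (Fin.succAbove_ne _ _))
  have hs1 : ∀ x, s (e1 x) = x := degeneracy_comp_face i _ fun b => Fin.predAbove_succAbove i b
  let lift : Finset (Fin (m + 1) → ℝ) → Finset (Fin (m + 2) → ℝ) :=
    fun T => T.image e0 ∪ T.image e1
  refine ⟨Q.image lift, ?_, ?_⟩
  · intro T' hT'
    obtain ⟨T, hT, rfl⟩ := Finset.mem_image.1 hT'
    obtain ⟨hne, hdim⟩ := hQ T hT
    refine ⟨(hne.image e0).mono Finset.subset_union_left, ?_⟩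
    have hle : cellDim (lift T) ≤ cellDim T + 1 := by
      have h1 : vectorSpan ℝ (lift T : Set (Fin (m + 2) → ℝ)) ≤
          (vectorSpan ℝ (T : Set (Fin (m + 1) → ℝ))).comap s := by
        rw [vectorSpan_def, Submodule.span_le]
        rintro _ ⟨x, hx, y, hy, rfl⟩
        have hmem : ∀ z ∈ (lift T : Set (Fin (m + 2) → ℝ)), s z ∈ T := by
          intro z hz
          simp only [lift, Finset.coe_union, Finset.coe_image, Set.mem_union, Set.mem_image,
            Finset.mem_coe] at hz
          obtain ⟨w, hw, rfl⟩ | ⟨w, hw, rfl⟩ := hz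
          · rwa [hs0]
          · rwa [hs1]
        change s (x - y) ∈ vectorSpan ℝ (T : Set (Fin (m + 1) → ℝ))
        rw [map_sub]
        exact vsub_mem_vectorSpan ℝ (s := (T : Set (Fin (m + 1) → ℝ))) (hmem x hx) (hmem y hy)
      have h2 := (Submodule.finrank_mono h1).trans (finrank_comap_degeneracy i _)
      unfold cellDim
      exact_mod_cast h2
    calc ExtInt.ofInt (cellDim (lift T)) ≤ ExtInt.ofInt (cellDim T + 1) :=
          WithBot.coe_le_coe.2 (WithTop.coe_le_coe.2 hle)
      _ = ExtInt.ofInt (cellDim T) + 1 := ExtInt.ofInt_add_one _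
      _ ≤ b + 1 := by gcongr
  · intro y hy
    obtain ⟨T, hT, hyT⟩ := hA _ hy
    refine ⟨lift T, Finset.mem_image_of_mem _ hT, ?_⟩
    obtain ⟨r, t, hr, ht, hrt, hyeq⟩ := degeneracy_lift i (y : Fin (m + 2) → ℝ) y.2.1
    change s y ∈ convexHull ℝ (T : Set (Fin (m + 1) → ℝ)) at hyT
    have hmem : ∀ e : (Fin (m + 1) → ℝ) →ₗ[ℝ] (Fin (m + 2) → ℝ),
        (∀ x ∈ T, e x ∈ lift T) → e (s y) ∈ convexHull ℝ (lift T : Set (Fin (m + 2) → ℝ)) := by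
      intro e he
      have h1 : e (s y) ∈ e '' convexHull ℝ (T : Set (Fin (m + 1) → ℝ)) := ⟨_, hyT, rfl⟩
      rw [e.image_convexHull] at h1
      refine convexHull_mono ?_ h1
      rintro _ ⟨x, hx, rfl⟩
      exact he x hx
    rw [← hyeq]
    exact convex_convexHull ℝ _
      (hmem e0 fun x hx => Finset.mem_union_left _ (Finset.mem_image_of_mem _ hx))
      (hmem e1 fun x hx => Finset.mem_union_right _ (Finset.mem_image_of_mem _ hx)) hr ht hrt

section Full

variable {X : Type u} [TopologicalSpace X] {n : ℕ} {F : FilteredSpace X n}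

lemma Perversity.Allowable.degeneracy {p : Perversity F} {m : ℕ}
    {σ : (TopCat.toSSet.obj (TopCat.of X)).obj (op ⦋m⦌)} (h : p.Allowable σ) (i : Fin (m + 1)) :
    p.Allowable ((TopCat.toSSet.obj (TopCat.of X)).map (SimplexCategory.σ i).op σ) := by
  intro S hS
  have := (h S hS).preimage_degeneracy i
  have e : (ExtInt.ofInt (((m + 1 : ℕ) : ℤ) - S.codim) + p.val S) =
      ExtInt.ofInt ((m : ℤ) - S.codim) + p.val S + 1 := by
    rw [add_right_comm, ← ExtInt.ofInt_add_one]
    congr 2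
    push_cast
    ring
  have e' := this
  rw [← e] at e'
  exact e'

lemma Perversity.Full.allowable_map {p : Perversity F} {d : SimplexCategoryᵒᵖ}
    {σ : (TopCat.toSSet.obj (TopCat.of X)).obj d} (h : p.Full σ) :
    ∀ (m : ℕ) (θ : ⦋m⦌ ⟶ d.unop), p.Allowable ((TopCat.toSSet.obj (TopCat.of X)).map θ.op σ) := by
  intro m
  induction m with
  | zero =>
    intro θ
    refine h _ θ fun a b _ => Subsingleton.elim (α := Fin 1) a b
  | succ m ih =>
    intro θ
    by_cases hθ : Function.Injective θ.toOrderHom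
    · exact h _ θ hθ
    · obtain ⟨i, θ', rfl⟩ := SimplexCategory.eq_σ_comp_of_not_injective θ hθ
      have := (ih θ').degeneracy i
      rw [op_comp, Functor.map_comp_apply]
      exact this

/-- The Gajer `p`-space of `X`: the simplicial subset of the singular simplicial set of `X`
formed by the `p`-full simplices. -/
def gajerSpace (p : Perversity F) : (TopCat.toSSet.obj (TopCat.of X)).Subcomplex where
  obj _ := {σ | p.Full σ}
  map {d e} f σ hσ := by
    intro c θ _
    induction c using SimplexCategory.rec with
    | _ m =>
    have := Perversity.Full.allowable_map hσ m (θ ≫ f.unop)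
    rw [op_comp, Functor.map_comp_apply] at this
    exact this

end Full

/-! ### Chain complexes -/

/-- The free abelian group functor, with `A ↦ ℤ^(A)` the finitely supported functions. -/
noncomputable def freeAb : Type u ⥤ AddCommGrpCat.{u} where
  obj A := AddCommGrpCat.of (A →₀ ℤ)
  map f := AddCommGrpCat.ofHom (Finsupp.mapDomain.addMonoidHom f)
  map_id A := by
    apply AddCommGrpCat.hom_ext
    apply AddMonoidHom.ext
    intro x
    change A →₀ ℤ at x
    exact Finsupp.mapDomain_id (v := x)
  map_comp f g := by
    apply AddCommGrpCat.hom_ext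
    apply AddMonoidHom.ext
    intro x
    change _ →₀ ℤ at x
    exact Finsupp.mapDomain_comp (f := f) (g := g) (v := x)

/-- The (unnormalized) chain complex `C_*(K; ℤ)` of a simplicial set: `C_m` is free on `K_m`,
and the differential is the alternating sum of the faces. -/
noncomputable def chains : SSet.{u} ⥤ ChainComplex AddCommGrpCat.{u} ℕ :=
  (SimplicialObject.whiskering _ _).obj freeAb ⋙
    AlgebraicTopology.alternatingFaceMapComplex AddCommGrpCat

section IntersectionChains

variable {X : Type u} [TopologicalSpace X] {n : ℕ} {F : FilteredSpace X n}

variable (X) in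
/-- The singular chain complex of `X`. -/
noncomputable abbrev singularChains : ChainComplex AddCommGrpCat.{u} ℕ :=
  chains.obj (TopCat.toSSet.obj (TopCat.of X))

/-- The chain of a singular simplex with coefficient `1`. -/
noncomputable def simplexChain {m : ℕ} (σ : (TopCat.toSSet.obj (TopCat.of X)).obj (op ⦋m⦌)) :
    (singularChains X).X m :=
  (Finsupp.single σ 1 : (TopCat.toSSet.obj (TopCat.of X)).obj (op ⦋m⦌) →₀ ℤ)

/-- The `p`-allowable chains: the linear combinations of `p`-allowable simplices. -/
noncomputable def allowableChains (p : Perversity F) (m : ℕ) :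
    AddSubgroup ((singularChains X).X m) :=
  AddSubgroup.closure {ξ | ∃ σ, p.Allowable σ ∧ ξ = simplexChain σ}

/-- The chains of `p`-intersection: the chains `ξ` such that `ξ` and `∂ξ` are `p`-allowable. -/
noncomputable def intersectionChains (p : Perversity F) (m : ℕ) :
    AddSubgroup ((singularChains X).X m) where
  carrier := {ξ | ξ ∈ allowableChains p m ∧
    ∀ k, (singularChains X).d m k ξ ∈ allowableChains p k}
  zero_mem' := ⟨zero_mem _, fun k => by rw [map_zero]; exact zero_mem _⟩
  add_mem' ha hb := ⟨add_mem ha.1 hb.1, fun k => by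
    rw [map_add]; exact add_mem (ha.2 k) (hb.2 k)⟩
  neg_mem' ha := ⟨neg_mem ha.1, fun k => by
    rw [map_neg]; exact neg_mem (ha.2 k)⟩

lemma d_d_apply (C : ChainComplex AddCommGrpCat.{u} ℕ) (i j k : ℕ) (ξ : C.X i) :
    C.d j k (C.d i j ξ) = 0 := by
  rw [← ConcreteCategory.comp_apply, HomologicalComplex.d_comp_d]; rfl

lemma d_mem_intersectionChains (p : Perversity F) (i j : ℕ) {ξ : (singularChains X).X i}
    (h : ξ ∈ intersectionChains p i) : (singularChains X).d i j ξ ∈ intersectionChains p j := by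
  refine ⟨h.2 j, fun k => ?_⟩
  rw [d_d_apply]
  exact zero_mem _

/-- The complex `C_*^p(X; ℤ)` of singular chains of `p`-intersection. -/
noncomputable def intersectionComplex (p : Perversity F) : ChainComplex AddCommGrpCat.{u} ℕ where
  X m := AddCommGrpCat.of (intersectionChains p m)
  d i j := AddCommGrpCat.ofHom
    ((((singularChains X).d i j).hom.comp (intersectionChains p i).subtype).codRestrict
      (intersectionChains p j) fun ξ => d_mem_intersectionChains p i j ξ.2)
  shape i j h := by
    ext ξ : 2
    apply Subtype.ext
    change (singularChains X).d i j ξ.1 = 0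
    rw [(singularChains X).shape i j h]; rfl
  d_comp_d' i j k _ _ := by
    ext ξ : 2
    apply Subtype.ext
    exact d_d_apply (singularChains X) i j k ξ.1

/-- The chain complex `C_*(𝒢ₚX; ℤ)` of the Gajer space. -/
noncomputable abbrev gajerChains (p : Perversity F) : ChainComplex AddCommGrpCat.{u} ℕ :=
  chains.obj (gajerSpace p).toSSet

/-- The chain map `C_*(𝒢ₚX; ℤ) → C_*(X; ℤ)` induced by the inclusion of simplicial sets. -/
noncomputable abbrev gajerToSingular (p : Perversity F) : gajerChains p ⟶ singularChains X :=
  chains.map (gajerSpace p).ι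

lemma gajerToSingular_mem_allowable (p : Perversity F) (m : ℕ) (ξ : (gajerChains p).X m) :
    (gajerToSingular p).f m ξ ∈ allowableChains p m := by
  change (gajerSpace p).obj (op ⦋m⦌) →₀ ℤ at ξ
  induction ξ using Finsupp.induction_linear with
  | zero => exact (map_zero ((gajerToSingular p).f m).hom).symm ▸ zero_mem _
  | add a b ha hb => exact (map_add ((gajerToSingular p).f m).hom a b).symm ▸ add_mem ha hb
  | single σ c =>
    have hσ : p.Allowable σ.1 := by
      have := σ.2 _ (𝟙 _) fun _ _ h => h
      rwa [op_id, Functor.map_id_apply] at this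
    have h : (gajerToSingular p).f m (Finsupp.single σ c :
        (gajerSpace p).obj (op ⦋m⦌) →₀ ℤ) = c • simplexChain σ.1 := by
      refine (Finsupp.mapDomain_single (f := ((gajerSpace p).ι.app (op ⦋m⦌)))).trans ?_
      exact (Finsupp.smul_single_one _ c).symm
    rw [h]
    have hmem : simplexChain σ.1 ∈ allowableChains p m :=
      AddSubgroup.subset_closure ⟨σ.1, hσ, rfl⟩
    exact zsmul_mem hmem c

lemma gajerToSingular_mem (p : Perversity F) (m : ℕ) (ξ : (gajerChains p).X m) :
    (gajerToSingular p).f m ξ ∈ intersectionChains p m := by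
  refine ⟨gajerToSingular_mem_allowable p m ξ, fun k => ?_⟩
  rw [← ConcreteCategory.comp_apply, (gajerToSingular p).comm m k, ConcreteCategory.comp_apply]
  exact gajerToSingular_mem_allowable p k _

/-- The inclusion of chain complexes `C_*(𝒢ₚX; ℤ) → C_*^p(X; ℤ)`. -/
noncomputable def gajerInclusion (p : Perversity F) : gajerChains p ⟶ intersectionComplex p where
  f m := AddCommGrpCat.ofHom
    (((gajerToSingular p).f m).hom.codRestrict (intersectionChains p m)
      fun ξ => gajerToSingular_mem p m ξ)
  comm' i j _ := by
    ext ξ : 2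
    apply Subtype.ext
    exact ConcreteCategory.congr_hom ((gajerToSingular p).comm i j) ξ

end IntersectionChains

/-! Let B j be the union of the singular strata S with j - codim S + p(S) < 0 (`Perversity.badSet`);
these sets decrease with j. A simplex is compact, so by local finiteness it meets only finitely many
strata, and allowability in low dimensions depends on the B j alone. An allowable point avoids B 0.
An allowable path avoids B 1 and meets B 0 finitely often. An allowable triangle avoids B 2, meets B
1 in finitely many points and B 0 inside finitely many lines. The difficulty is that faces are not
controlled: a path may end in B 0, and an edge of an allowable triangle may lie in B 0 or meet B 1.

Surjectivity. Allowable points are full. An allowable path has a parameter outside B 0; cut there,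
it becomes a difference of two probes, i.e. allowable paths that start outside B 0. Two probes with
the same end differ, up to a boundary, by a full path. Replacing each probe with bad end by a fixed
one, a path becomes a full chain, plus a boundary, plus a chain that depends linearly on the
boundary of the path (`exists_allowable_decomposition`). The last term vanishes on cycles.

Injectivity. Project full chains onto their quotient by boundaries of full simplices. If this
cocycle extends to a cochain that kills the boundaries of all allowable simplices, then a full chain
that bounds an allowable chain has class zero. In degree 0 the value at a bad point is read at the
start of any probe that ends there (`exists_extension_of_forall_isFullPath`).

In degree 1 (`IsFullCocycle.exists_extension`), take a point b in general position in an allowable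
triangle and give the edge from v to w the value Ψ(bw) - Ψ(bv), where Ψ is a function on probes; the
three values of a triangle then telescope. To compare two triangles with a common edge, join their
generic points by a full path α that crosses the edge at a generic point. The triangles cut along α
show that both probes change by the same amount φ(α), provided that Ψ is a potential for such
changes (`IsSector`, `IsFullCocycle.exists_potential`). A potential exists because a sector whose
two sides are the same path has value zero: three copies of it, the middle one reversed, close up
around the barycenter to a full triangle (`IsAllowableTriangle.exists_fold`). -/

/-! ### Affine simplices in standard simplices -/

/-- The `i`-th vertex of a standard simplex. -/
noncomputable abbrev vtx {k : ℕ} (i : Fin k) : stdSimplex ℝ (Fin k) := stdSimplex.vertex i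

/-- The affine simplex with given vertices in a standard simplex. -/
noncomputable def affineSimplex {k l : ℕ} (v : Fin k → stdSimplex ℝ (Fin l)) :
    C(stdSimplex ℝ (Fin k), stdSimplex ℝ (Fin l)) where
  toFun t := ⟨Fintype.linearCombination ℝ (fun i => ⇑(v i)) ⇑t, by
    rw [Fintype.linearCombination_apply]
    exact (convex_stdSimplex ℝ (Fin l)).sum_mem (fun i _ => t.2.1 i) t.2.2 fun i _ => (v i).2⟩
  continuous_toFun := by
    refine Continuous.subtype_mk ?_ _
    exact (LinearMap.continuous_of_finiteDimensional
      (Fintype.linearCombination ℝ fun i => ⇑(v i))).comp continuous_subtype_val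

lemma coe_affineSimplex {k l : ℕ} (v : Fin k → stdSimplex ℝ (Fin l)) (t : stdSimplex ℝ (Fin k)) :
    ⇑(affineSimplex v t) = Fintype.linearCombination ℝ (fun i => ⇑(v i)) ⇑t := rfl

lemma affineSimplex_apply {k l : ℕ} (v : Fin k → stdSimplex ℝ (Fin l)) (t : stdSimplex ℝ (Fin k))
    (j : Fin l) : affineSimplex v t j = ∑ i, t i * v i j := by
  rw [coe_affineSimplex, Fintype.linearCombination_apply]
  simp

lemma map_affineSimplex {k l : ℕ} (f : (Fin l → ℝ) →ₗ[ℝ] ℝ) (v : Fin k → stdSimplex ℝ (Fin l))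
    (t : stdSimplex ℝ (Fin k)) : f (affineSimplex v t) = ∑ i, t i * f (v i) := by
  rw [coe_affineSimplex, Fintype.linearCombination_apply]
  simp

@[simp]
lemma affineSimplex_vertex {k l : ℕ} (v : Fin k → stdSimplex ℝ (Fin l)) (i : Fin k) :
    affineSimplex v (vtx i) = v i := by
  apply stdSimplex.ext
  funext j
  rw [affineSimplex_apply]
  simp [Pi.single_apply]

lemma affineSimplex_comp {k l m : ℕ} (v : Fin l → stdSimplex ℝ (Fin m))
    (w : Fin k → stdSimplex ℝ (Fin l)) :
    (affineSimplex v).comp (affineSimplex w) = affineSimplex fun i => affineSimplex v (w i) := by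
  ext t : 1
  apply stdSimplex.ext
  funext j
  simp only [ContinuousMap.comp_apply, affineSimplex_apply, Finset.sum_mul, Finset.mul_sum]
  rw [Finset.sum_comm]
  simp only [mul_assoc]

lemma affineSimplex_vtx (k : ℕ) :
    affineSimplex (vtx : Fin k → stdSimplex ℝ (Fin k)) = ContinuousMap.id _ := by
  ext t : 1
  apply stdSimplex.ext
  funext j
  simp [affineSimplex_apply, Pi.single_apply]

lemma map_eq_affineSimplex {k l : ℕ} (f : Fin k → Fin l) (t : stdSimplex ℝ (Fin k)) :
    stdSimplex.map f t = affineSimplex (fun i => vtx (f i)) t := by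
  apply stdSimplex.ext
  funext j
  rw [affineSimplex_apply, stdSimplex.map_coe, FunOnFinite.linearMap_apply_apply]
  simp [Pi.single_apply, Finset.sum_filter, eq_comm]

/-- The affine segment from `x` to `y` in a standard simplex. -/
noncomputable abbrev seg {l : ℕ} (x y : stdSimplex ℝ (Fin l)) :
    C(stdSimplex ℝ (Fin 2), stdSimplex ℝ (Fin l)) := affineSimplex ![x, y]

/-- The affine triangle with vertices `x`, `y`, `z` in a standard simplex. -/
noncomputable abbrev tri {l : ℕ} (x y z : stdSimplex ℝ (Fin l)) :
    C(stdSimplex ℝ (Fin 3), stdSimplex ℝ (Fin l)) := affineSimplex ![x, y, z]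

lemma affineSimplex_comp_seg {k l : ℕ} (v : Fin k → stdSimplex ℝ (Fin l))
    (x y : stdSimplex ℝ (Fin k)) :
    (affineSimplex v).comp (seg x y) = seg (affineSimplex v x) (affineSimplex v y) := by
  rw [affineSimplex_comp]
  congr 1
  exact List.ofFn_inj.1 rfl

@[simp] lemma seg_zero {l : ℕ} (x y : stdSimplex ℝ (Fin l)) : seg x y (vtx 0) = x :=
  affineSimplex_vertex _ _

@[simp] lemma seg_one {l : ℕ} (x y : stdSimplex ℝ (Fin l)) : seg x y (vtx 1) = y :=
  affineSimplex_vertex _ _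

@[simp] lemma tri_zero {l : ℕ} (x y z : stdSimplex ℝ (Fin l)) : tri x y z (vtx 0) = x :=
  affineSimplex_vertex _ _

@[simp] lemma tri_one {l : ℕ} (x y z : stdSimplex ℝ (Fin l)) : tri x y z (vtx 1) = y :=
  affineSimplex_vertex _ _

@[simp] lemma tri_two {l : ℕ} (x y z : stdSimplex ℝ (Fin l)) : tri x y z (vtx 2) = z :=
  affineSimplex_vertex _ _

lemma seg_apply {l : ℕ} (x y : stdSimplex ℝ (Fin l)) (t : stdSimplex ℝ (Fin 2)) (j : Fin l) :
    seg x y t j = t 0 * x j + t 1 * y j := by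
  simp [affineSimplex_apply, Fin.sum_univ_two]

lemma tri_apply {l : ℕ} (x y z : stdSimplex ℝ (Fin l)) (t : stdSimplex ℝ (Fin 3)) (j : Fin l) :
    tri x y z t j = t 0 * x j + t 1 * y j + t 2 * z j := by
  simp [affineSimplex_apply, Fin.sum_univ_three]

lemma seg_vtx : seg (vtx 0) (vtx 1) = ContinuousMap.id (stdSimplex ℝ (Fin 2)) := by
  rw [← affineSimplex_vtx]
  congr 1

lemma stdSimplex.add_add_eq_one (t : stdSimplex ℝ (Fin 3)) : t 0 + t 1 + t 2 = 1 := by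
  simpa only [Fin.sum_univ_three] using stdSimplex.sum_eq_one t

lemma stdSimplex.ext_two {s t : stdSimplex ℝ (Fin 2)} (h : s 0 = t 0) : s = t := by
  have h1 := stdSimplex.add_eq_one s
  have h2 := stdSimplex.add_eq_one t
  apply stdSimplex.ext
  funext i
  fin_cases i
  · exact h
  · change s 1 = t 1
    linarith

lemma stdSimplex.ext_three {s t : stdSimplex ℝ (Fin 3)} (h : s 0 = t 0) (h' : s 1 = t 1) :
    s = t := by
  have h1 := stdSimplex.add_add_eq_one s
  have h2 := stdSimplex.add_add_eq_one t
  apply stdSimplex.ext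
  funext i
  fin_cases i
  · exact h
  · exact h'
  · change s 2 = t 2
    linarith

/-- The point of the standard `1`-simplex with first coordinate `a`. -/
noncomputable def pointOne (a : ℝ) (h0 : 0 ≤ a) (h1 : a ≤ 1) : stdSimplex ℝ (Fin 2) :=
  ⟨![a, 1 - a], by
    refine ⟨fun i => ?_, by simp [Fin.sum_univ_two]⟩
    fin_cases i
    · exact h0
    · simpa using h1⟩

@[simp] lemma pointOne_zero (a : ℝ) (h0 : 0 ≤ a) (h1 : a ≤ 1) : pointOne a h0 h1 0 = a := rfl

/-- The point of the standard `2`-simplex with given coordinates. -/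
noncomputable def pointTwo (a b c : ℝ) (ha : 0 ≤ a) (hb : 0 ≤ b) (hc : 0 ≤ c)
    (h : a + b + c = 1) : stdSimplex ℝ (Fin 3) :=
  ⟨![a, b, c], by
    refine ⟨fun i => ?_, by simp [Fin.sum_univ_three, h]⟩
    fin_cases i
    · exact ha
    · exact hb
    · exact hc⟩

@[simp] lemma pointTwo_zero {a b c : ℝ} (ha : 0 ≤ a) (hb : 0 ≤ b) (hc : 0 ≤ c)
    (h : a + b + c = 1) : pointTwo a b c ha hb hc h 0 = a := rfl

@[simp] lemma pointTwo_one {a b c : ℝ} (ha : 0 ≤ a) (hb : 0 ≤ b) (hc : 0 ≤ c)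
    (h : a + b + c = 1) : pointTwo a b c ha hb hc h 1 = b := rfl

@[simp] lemma pointTwo_two {a b c : ℝ} (ha : 0 ≤ a) (hb : 0 ≤ b) (hc : 0 ≤ c)
    (h : a + b + c = 1) : pointTwo a b c ha hb hc h 2 = c := rfl

/-- The midpoint of the segment between two points of a standard simplex. -/
noncomputable def midpt {l : ℕ} (x y : stdSimplex ℝ (Fin l)) : stdSimplex ℝ (Fin l) :=
  seg x y (pointOne (1 / 2) (by norm_num) (by norm_num))

lemma midpt_apply {l : ℕ} (x y : stdSimplex ℝ (Fin l)) (j : Fin l) :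
    midpt x y j = (x j + y j) / 2 := by
  rw [midpt, seg_apply]
  have : pointOne (1 / 2) (by norm_num) (by norm_num) 1 = 1 - 1 / 2 := rfl
  rw [this, pointOne_zero]
  ring

lemma affineSimplex_midpt {k l : ℕ} (v : Fin k → stdSimplex ℝ (Fin l))
    (x y : stdSimplex ℝ (Fin k)) :
    affineSimplex v (midpt x y) = midpt (affineSimplex v x) (affineSimplex v y) := by
  rw [midpt, ← ContinuousMap.comp_apply, affineSimplex_comp_seg]
  rfl

lemma seg_injective {l : ℕ} {x y : stdSimplex ℝ (Fin l)} (h : x ≠ y) :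
    Function.Injective (seg x y) := by
  intro s t hst
  obtain ⟨j, hj⟩ : ∃ j, x j ≠ y j := by
    by_contra! h'
    exact h (stdSimplex.ext (funext h'))
  have h1 := DFunLike.congr_fun hst j
  rw [seg_apply, seg_apply] at h1
  have h2 := stdSimplex.add_eq_one s
  have h3 := stdSimplex.add_eq_one t
  apply stdSimplex.ext_two
  have h4 : (s 0 - t 0) * (x j - y j) = 0 := by
    have e1 : s 1 = 1 - s 0 := by linarith
    have e2 : t 1 = 1 - t 0 := by linarith
    rw [e1, e2] at h1
    linarith
  rcases mul_eq_zero.1 h4 with h5 | h5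
  · linarith
  · exact absurd (by linarith) hj

/-- Linear independence replaces affine independence: the two agree for points of the hyperplane
where the coordinates sum to 1. -/
lemma affineSimplex_injective {k l : ℕ} {v : Fin k → stdSimplex ℝ (Fin l)}
    (h : LinearIndependent ℝ fun i => ⇑(v i)) : Function.Injective (affineSimplex v) := by
  intro s t hst
  apply stdSimplex.ext
  exact (linearIndependent_iff_injective_fintypeLinearCombination.1 h) (congrArg Subtype.val hst)

lemma linearIndependent_three {l : ℕ} {x y z : stdSimplex ℝ (Fin l)}
    (h : ∀ a b c : ℝ, (∀ j, a * x j + b * y j + c * z j = 0) → a = 0 ∧ b = 0 ∧ c = 0) :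
    LinearIndependent ℝ fun i => ⇑((![x, y, z] : Fin 3 → stdSimplex ℝ (Fin l)) i) := by
  rw [Fintype.linearIndependent_iff]
  intro g hg i
  have := h (g 0) (g 1) (g 2) fun j => by
    have := congrFun hg j
    simpa [Fin.sum_univ_three] using this
  fin_cases i
  · exact this.1
  · exact this.2.1
  · exact this.2.2

lemma LinearIndependent.three_eq_zero {l : ℕ} {x y z : stdSimplex ℝ (Fin l)}
    (h : LinearIndependent ℝ fun i => ⇑((![x, y, z] : Fin 3 → stdSimplex ℝ (Fin l)) i))
    {a b c : ℝ} (habc : ∀ j, a * x j + b * y j + c * z j = 0) : a = 0 ∧ b = 0 ∧ c = 0 := by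
  rw [Fintype.linearIndependent_iff] at h
  have := h ![a, b, c] (by
    funext j
    simpa [Fin.sum_univ_three] using habc j)
  exact ⟨this 0, this 1, this 2⟩

/-! ### Gluing -/

/-- Continuous maps on affine simplices that cover a standard simplex can be glued. -/
lemma exists_glue {X : Type*} [TopologicalSpace X] {ι : Type} [Finite ι] {k l : ℕ}
    (v : ι → Fin k → stdSimplex ℝ (Fin l))
    (hv : ∀ x, ∃ i y, affineSimplex (v i) y = x) (τ : ι → C(stdSimplex ℝ (Fin k), X))
    (hτ : ∀ i j y y', affineSimplex (v i) y = affineSimplex (v j) y' → τ i y = τ j y') :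
    ∃ ρ : C(stdSimplex ℝ (Fin l), X), ∀ i, ρ.comp (affineSimplex (v i)) = τ i := by
  let q : C((Σ _ : ι, stdSimplex ℝ (Fin k)), stdSimplex ℝ (Fin l)) :=
    ⟨fun z => affineSimplex (v z.1) z.2,
      continuous_sigma fun i => (affineSimplex (v i)).continuous⟩
  let f : C((Σ _ : ι, stdSimplex ℝ (Fin k)), X) := ⟨fun z => τ z.1 z.2,
      continuous_sigma fun i => (τ i).continuous⟩
  -- A continuous surjection from a compact space to a Hausdorff space is a quotient map, so
  -- agreement on overlaps is all that gluing needs.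
  have hq : IsQuotientMap q := by
    refine IsQuotientMap.of_surjective_continuous ?_ q.continuous
    intro x
    obtain ⟨i, y, h⟩ := hv x
    exact ⟨⟨i, y⟩, h⟩
  have hf : Function.FactorsThrough f q := by
    rintro ⟨i, y⟩ ⟨j, y'⟩ hab
    exact hτ i j y y' hab
  refine ⟨hq.lift f hf, fun i => ?_⟩
  ext y : 1
  have h := DFunLike.congr_fun (hq.lift_comp f hf) ⟨i, y⟩
  exact h

lemma exists_seg_halves (t : stdSimplex ℝ (Fin 2)) :
    (∃ s, seg (vtx 0) (midpt (vtx 0) (vtx 1)) s = t) ∨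
      ∃ s, seg (midpt (vtx 0) (vtx 1)) (vtx 1) s = t := by
  have h := stdSimplex.add_eq_one t
  have h0 := stdSimplex.zero_le t 0
  have h1 := stdSimplex.zero_le t 1
  rcases le_total (t 1) (t 0) with h2 | h2
  · refine Or.inl ⟨pointOne (t 0 - t 1) (by linarith) (by linarith), stdSimplex.ext_two ?_⟩
    have : pointOne (t 0 - t 1) (by linarith) (by linarith) 1 = 1 - (t 0 - t 1) := rfl
    rw [seg_apply, midpt_apply, this]
    simp
    linarith
  · refine Or.inr ⟨pointOne (2 * t 0) (by linarith) (by linarith), stdSimplex.ext_two ?_⟩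
    rw [seg_apply, midpt_apply]
    simp
    ring

/-- Concatenation of paths. -/
lemma exists_concat {X : Type*} [TopologicalSpace X] (γ γ' : C(stdSimplex ℝ (Fin 2), X))
    (h : γ (vtx 1) = γ' (vtx 0)) : ∃ δ : C(stdSimplex ℝ (Fin 2), X),
      δ.comp (seg (vtx 0) (midpt (vtx 0) (vtx 1))) = γ ∧
        δ.comp (seg (midpt (vtx 0) (vtx 1)) (vtx 1)) = γ' := by
  have h01 : (vtx 0 : stdSimplex ℝ (Fin 2)) 0 = 1 := by simp
  have h11 : (vtx 1 : stdSimplex ℝ (Fin 2)) 0 = 0 := by simp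
  -- The first coordinates give s 0 + t 1 = 0 with both terms nonnegative: the halves meet only at
  -- the midpoint.
  have key : ∀ s t : stdSimplex ℝ (Fin 2),
      seg (vtx 0 : stdSimplex ℝ (Fin 2)) (midpt (vtx 0) (vtx 1)) s =
      seg (midpt (vtx 0) (vtx 1)) (vtx 1) t → γ s = γ' t := by
    intro s t hst
    have h1 := DFunLike.congr_fun hst (0 : Fin 2)
    rw [seg_apply, seg_apply, midpt_apply, h01, h11] at h1
    have hs := stdSimplex.add_eq_one s
    have ht := stdSimplex.add_eq_one t
    have hs0 := stdSimplex.zero_le s 0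
    have ht1 := stdSimplex.zero_le t 1
    have e1 : s = vtx 1 := stdSimplex.ext_two (by rw [h11]; linarith)
    have e2 : t = vtx 0 := stdSimplex.ext_two (by rw [h01]; linarith)
    rw [e1, e2, h]
  have hne : (vtx 0 : stdSimplex ℝ (Fin 2)) ≠ midpt (vtx 0) (vtx 1) := by
    intro h'
    have := DFunLike.congr_fun h' 0
    rw [midpt_apply, h01, h11] at this
    norm_num at this
  have hne' : midpt (vtx 0) (vtx 1) ≠ (vtx 1 : stdSimplex ℝ (Fin 2)) := by
    intro h'
    have := DFunLike.congr_fun h' 0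
    rw [midpt_apply, h01, h11] at this
    norm_num at this
  obtain ⟨δ, hδ⟩ := exists_glue (ι := Bool)
    (fun i => cond i ![vtx 0, midpt (vtx 0) (vtx 1)] ![midpt (vtx 0) (vtx 1), vtx 1])
    (fun x => by
      rcases exists_seg_halves x with ⟨s, hs⟩ | ⟨s, hs⟩
      · exact ⟨true, s, hs⟩
      · exact ⟨false, s, hs⟩) (fun i => cond i γ γ') (by
      rintro (_ | _) (_ | _) s t hst
      · exact congrArg γ' (seg_injective hne' hst)
      · exact (key _ _ hst.symm).symm
      · exact key _ _ hst
      · exact congrArg γ (seg_injective hne hst))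
  exact ⟨δ, hδ true, hδ false⟩

lemma linearIndependent_half_left : LinearIndependent ℝ fun i =>
    ⇑((![vtx 0, midpt (vtx 0) (vtx 1), vtx 2] : Fin 3 → stdSimplex ℝ (Fin 3)) i) := by
  refine linearIndependent_three fun a b c h => ?_
  have h0 := h 0
  have h1 := h 1
  have h2 := h 2
  simp [midpt_apply] at h0 h1 h2
  refine ⟨?_, h1, h2⟩
  simpa [h1] using h0

lemma linearIndependent_half_right : LinearIndependent ℝ fun i =>
    ⇑((![midpt (vtx 0) (vtx 1), vtx 1, vtx 2] : Fin 3 → stdSimplex ℝ (Fin 3)) i) := by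
  refine linearIndependent_three fun a b c h => ?_
  have h0 := h 0
  have h1 := h 1
  have h2 := h 2
  simp [midpt_apply] at h0 h1 h2
  refine ⟨h0, ?_, h2⟩
  simpa [h0] using h1

lemma exists_tri_halves (t : stdSimplex ℝ (Fin 3)) :
    (∃ s, tri (vtx 0) (midpt (vtx 0) (vtx 1)) (vtx 2) s = t) ∨
      ∃ s, tri (midpt (vtx 0) (vtx 1)) (vtx 1) (vtx 2) s = t := by
  have h := stdSimplex.add_add_eq_one t
  have h0 := stdSimplex.zero_le t 0
  have h1 := stdSimplex.zero_le t 1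
  have h2 := stdSimplex.zero_le t 2
  rcases le_total (t 1) (t 0) with h3 | h3
  · refine Or.inl ⟨pointTwo (t 0 - t 1) (2 * t 1) (t 2) (by linarith) (by linarith) h2
      (by linarith), stdSimplex.ext_three ?_ ?_⟩ <;> rw [tri_apply, midpt_apply] <;> simp <;> ring
  · refine Or.inr ⟨pointTwo (2 * t 0) (t 1 - t 0) (t 2) (by linarith) (by linarith) h2
      (by linarith), stdSimplex.ext_three ?_ ?_⟩ <;> rw [tri_apply, midpt_apply] <;> simp <;> ring

/-- Two `2`-simplices with a common edge can be glued to a `2`-simplex divided by a median. -/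
lemma exists_glue_median {X : Type*} [TopologicalSpace X] (τ τ' : C(stdSimplex ℝ (Fin 3), X))
    (h : τ.comp (seg (vtx 1) (vtx 2)) = τ'.comp (seg (vtx 0) (vtx 2))) :
    ∃ ρ : C(stdSimplex ℝ (Fin 3), X),
      ρ.comp (tri (vtx 0) (midpt (vtx 0) (vtx 1)) (vtx 2)) = τ ∧
        ρ.comp (tri (midpt (vtx 0) (vtx 1)) (vtx 1) (vtx 2)) = τ' := by
  -- The first two coordinates give s 0 + t 1 = 0, so both vanish: the halves meet only along the
  -- median.
  have key : ∀ s t : stdSimplex ℝ (Fin 3),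
      tri (vtx 0 : stdSimplex ℝ (Fin 3)) (midpt (vtx 0) (vtx 1)) (vtx 2) s =
      tri (midpt (vtx 0) (vtx 1)) (vtx 1) (vtx 2) t → τ s = τ' t := by
    intro s t hst
    have h1 := DFunLike.congr_fun hst (0 : Fin 3)
    have h2 := DFunLike.congr_fun hst (1 : Fin 3)
    have h3 := DFunLike.congr_fun hst (2 : Fin 3)
    rw [tri_apply, tri_apply, midpt_apply] at h1 h2 h3
    simp at h1 h2 h3
    have hs := stdSimplex.add_add_eq_one s
    have ht := stdSimplex.add_add_eq_one t
    have hs0 := stdSimplex.zero_le s 0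
    have hs1 := stdSimplex.zero_le s 1
    have ht1 := stdSimplex.zero_le t 1
    have e : s 0 = 0 := by linarith
    have e' : t 1 = 0 := by linarith
    have e1 : s = seg (vtx 1) (vtx 2) (pointOne (s 1) hs1 (stdSimplex.le_one s 1)) := by
      apply stdSimplex.ext_three <;> rw [seg_apply] <;> simp [e]
    have e2 : t = seg (vtx 0) (vtx 2) (pointOne (s 1) hs1 (stdSimplex.le_one s 1)) := by
      apply stdSimplex.ext_three <;> rw [seg_apply] <;> simp [e']
      linarith
    rw [e1, e2]
    exact DFunLike.congr_fun h _
  obtain ⟨ρ, hρ⟩ := exists_glue (ι := Bool)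
    (fun i => cond i ![vtx 0, midpt (vtx 0) (vtx 1), vtx 2] ![midpt (vtx 0) (vtx 1), vtx 1, vtx 2])
    (fun x => by
      rcases exists_tri_halves x with ⟨s, hs⟩ | ⟨s, hs⟩
      · exact ⟨true, s, hs⟩
      · exact ⟨false, s, hs⟩) (fun i => cond i τ τ') (by
      rintro (_ | _) (_ | _) s t hst
      · exact congrArg τ' (affineSimplex_injective linearIndependent_half_right hst)
      · exact (key _ _ hst.symm).symm
      · exact key _ _ hst
      · exact congrArg τ (affineSimplex_injective linearIndependent_half_left hst))
  exact ⟨ρ, hρ true, hρ false⟩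

/-- The vertices of the three triangles with vertex at the barycenter of the `2`-simplex. -/
noncomputable def radialVertices (i : Fin 3) : Fin 3 → stdSimplex ℝ (Fin 3) :=
  ![vtx i, vtx (i + 1), stdSimplex.barycenter]

lemma barycenter_three (j : Fin 3) : (stdSimplex.barycenter : stdSimplex ℝ (Fin 3)) j = 1 / 3 := by
  have := stdSimplex.barycenter_apply (𝕜 := ℝ) j
  rw [Fintype.card_fin] at this
  rw [one_div]
  exact_mod_cast this

lemma linearIndependent_radialVertices (i : Fin 3) :
    LinearIndependent ℝ fun j => ⇑(radialVertices i j) := by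
  refine linearIndependent_three fun a b c h => ?_
  have h0 := h 0
  have h1 := h 1
  have h2 := h 2
  rw [barycenter_three] at h0 h1 h2
  fin_cases i <;> simp at h0 h1 h2 <;> simp_all

lemma radial_apply (i : Fin 3) (t : stdSimplex ℝ (Fin 3)) :
    affineSimplex (radialVertices i) t i = t 0 + t 2 / 3 ∧
    affineSimplex (radialVertices i) t (i + 1) = t 1 + t 2 / 3 ∧
    affineSimplex (radialVertices i) t (i + 2) = t 2 / 3 := by
  refine ⟨?_, ?_, ?_⟩ <;> refine (tri_apply _ _ _ _ _).trans ?_ <;> rw [barycenter_three] <;>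
    fin_cases i <;> simp <;> ring

/-- A point lies in the triangle over the side opposite to its smallest coordinate `x (i + 2)`. Its
coordinates there are the excesses of the other two over this minimum, and three times the minimum.
-/
lemma exists_radial (x : stdSimplex ℝ (Fin 3)) : ∃ i y, affineSimplex (radialVertices i) y = x := by
  have h := stdSimplex.add_add_eq_one x
  have h0 := stdSimplex.zero_le x 0
  have h1 := stdSimplex.zero_le x 1
  have h2 := stdSimplex.zero_le x 2
  have key : ∀ i : Fin 3, x i + x (i + 1) + x (i + 2) = 1 → x (i + 2) ≤ x i →
      x (i + 2) ≤ x (i + 1) → 0 ≤ x (i + 2) →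
      ∃ y, affineSimplex (radialVertices i) y = x := by
    intro i hi ha hb hc
    refine ⟨pointTwo (x i - x (i + 2)) (x (i + 1) - x (i + 2)) (3 * x (i + 2)) (by linarith)
      (by linarith) (by linarith) (by linarith), ?_⟩
    obtain ⟨e0, e1, e2⟩ := radial_apply i (pointTwo (x i - x (i + 2)) (x (i + 1) - x (i + 2))
      (3 * x (i + 2)) (by linarith) (by linarith) (by linarith) (by linarith))
    simp only [pointTwo_zero, pointTwo_one, pointTwo_two] at e0 e1 e2
    apply stdSimplex.ext
    funext j
    have hj : j = i ∨ j = i + 1 ∨ j = i + 2 := by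
      clear * -
      revert i j
      decide
    rcases hj with rfl | rfl | rfl
    · rw [e0]; ring
    · rw [e1]; ring
    · rw [e2]; ring
  rcases le_total (x 0) (x 1) with a | a <;> rcases le_total (x 1) (x 2) with b | b <;>
    rcases le_total (x 0) (x 2) with c | c
  · exact ⟨1, key 1 (by change x 1 + x 2 + x 0 = 1; linarith) a c h0⟩
  · exact ⟨1, key 1 (by change x 1 + x 2 + x 0 = 1; linarith) a (by change x 0 ≤ x 2; linarith) h0⟩
  · exact ⟨1, key 1 (by change x 1 + x 2 + x 0 = 1; linarith) a c h0⟩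
  · exact ⟨0, key 0 h c b h2⟩
  · exact ⟨2, key 2 (by change x 2 + x 0 + x 1 = 1; linarith) b a h1⟩
  · exact ⟨2, key 2 (by change x 2 + x 0 + x 1 = 1; linarith) b a h1⟩
  · exact ⟨0, key 0 h (by change x 2 ≤ x 0; linarith) b h2⟩
  · exact ⟨0, key 0 h c b h2⟩

/-! ### Allowable paths and triangles for a decreasing sequence of subsets -/

/-- A subset of the standard `2`-simplex is covered by lines if it is covered by finitely many
zero sets of nonzero linear forms. -/
def CoveredByLines (A : Set (stdSimplex ℝ (Fin 3))) : Prop :=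
  ∃ L : Set ((Fin 3 → ℝ) →ₗ[ℝ] ℝ), L.Finite ∧ (∀ f ∈ L, f ≠ 0) ∧ ∀ x ∈ A, ∃ f ∈ L, f ⇑x = 0

section Allowability

variable {X : Type*} [TopologicalSpace X] (B : ℕ → Set X)

/-- The path meets `B 0` in finitely many parameters, and does not meet `B 1`. -/
structure IsAllowablePath (γ : C(stdSimplex ℝ (Fin 2), X)) : Prop where
  finite : {t | γ t ∈ B 0}.Finite
  notMem : ∀ t, γ t ∉ B 1

/-- The triangle meets `B 0` along finitely many lines, `B 1` in finitely many parameters, and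
does not meet `B 2`. -/
structure IsAllowableTriangle (τ : C(stdSimplex ℝ (Fin 3), X)) : Prop where
  lines : CoveredByLines {t | τ t ∈ B 0}
  finite : {t | τ t ∈ B 1}.Finite
  notMem : ∀ t, τ t ∉ B 2

/-- An allowable path with end points outside `B 0`. -/
structure IsFullPath (γ : C(stdSimplex ℝ (Fin 2), X)) : Prop extends IsAllowablePath B γ where
  zero : γ (vtx 0) ∉ B 0
  one : γ (vtx 1) ∉ B 0

/-- An allowable triangle whose edges are full. -/
structure IsFullTriangle (τ : C(stdSimplex ℝ (Fin 3), X)) : Prop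
    extends IsAllowableTriangle B τ where
  edge01 : IsFullPath B (τ.comp (seg (vtx 0) (vtx 1)))
  edge02 : IsFullPath B (τ.comp (seg (vtx 0) (vtx 2)))
  edge12 : IsFullPath B (τ.comp (seg (vtx 1) (vtx 2)))

variable {B}

/-! ### Restriction, covering and gluing of allowable maps. -/

lemma comp_affineSimplex_comp_seg {k l : ℕ} (τ : C(stdSimplex ℝ (Fin l), X))
    (v : Fin k → stdSimplex ℝ (Fin l)) (x y : stdSimplex ℝ (Fin k)) :
    (τ.comp (affineSimplex v)).comp (seg x y) =
      τ.comp (seg (affineSimplex v x) (affineSimplex v y)) := by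
  rw [ContinuousMap.comp_assoc, affineSimplex_comp_seg]

/-- Three independent vertices define a linear automorphism of ℝ³, so nonzero forms pull back to
nonzero forms. -/
lemma CoveredByLines.preimage {A : Set (stdSimplex ℝ (Fin 3))} (h : CoveredByLines A)
    {v : Fin 3 → stdSimplex ℝ (Fin 3)} (hv : LinearIndependent ℝ fun i => ⇑(v i)) :
    CoveredByLines (affineSimplex v ⁻¹' A) := by
  obtain ⟨L, hL, h0, hA⟩ := h
  refine ⟨(fun f => f ∘ₗ Fintype.linearCombination ℝ fun i => ⇑(v i)) '' L, hL.image _, ?_, ?_⟩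
  · rintro _ ⟨f, hf, rfl⟩ h
    have hs := LinearMap.injective_iff_surjective.1
      (linearIndependent_iff_injective_fintypeLinearCombination.1 hv)
    refine h0 f hf (LinearMap.ext fun x => ?_)
    obtain ⟨y, rfl⟩ := hs x
    exact DFunLike.congr_fun h y
  · intro x hx
    obtain ⟨f, hf, hfx⟩ := hA _ hx
    exact ⟨_, ⟨f, hf, rfl⟩, hfx⟩

lemma CoveredByLines.image {A : Set (stdSimplex ℝ (Fin 3))} (h : CoveredByLines A)
    {v : Fin 3 → stdSimplex ℝ (Fin 3)} (hv : LinearIndependent ℝ fun i => ⇑(v i)) :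
    CoveredByLines (affineSimplex v '' A) := by
  obtain ⟨L, hL, h0, hA⟩ := h
  let e := LinearEquiv.ofInjectiveEndo (Fintype.linearCombination ℝ fun i => ⇑(v i))
    (linearIndependent_iff_injective_fintypeLinearCombination.1 hv)
  refine ⟨(fun f => f ∘ₗ e.symm.toLinearMap) '' L, hL.image _, ?_, ?_⟩
  · rintro _ ⟨f, hf, rfl⟩ h
    refine h0 f hf (LinearMap.ext fun x => ?_)
    have := DFunLike.congr_fun h (e x)
    simpa using this
  · rintro _ ⟨x, hx, rfl⟩
    obtain ⟨f, hf, hfx⟩ := hA _ hx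
    refine ⟨_, ⟨f, hf, rfl⟩, ?_⟩
    have : e.symm (e ⇑x) = ⇑x := e.symm_apply_apply _
    rw [← hfx]
    exact congrArg f this

lemma CoveredByLines.iUnion {ι : Type*} [Finite ι] {A : ι → Set (stdSimplex ℝ (Fin 3))}
    (h : ∀ i, CoveredByLines (A i)) : CoveredByLines (⋃ i, A i) := by
  choose L hL h0 hA using h
  refine ⟨⋃ i, L i, Set.finite_iUnion hL, ?_, ?_⟩
  · intro f hf
    obtain ⟨i, hi⟩ := Set.mem_iUnion.1 hf
    exact h0 i f hi
  · intro x hx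
    obtain ⟨i, hi⟩ := Set.mem_iUnion.1 hx
    obtain ⟨f, hf, hfx⟩ := hA i x hi
    exact ⟨f, Set.mem_iUnion.2 ⟨i, hf⟩, hfx⟩

lemma CoveredByLines.mono {A A' : Set (stdSimplex ℝ (Fin 3))} (h : CoveredByLines A)
    (h' : A' ⊆ A) : CoveredByLines A' := by
  obtain ⟨L, hL, h0, hA⟩ := h
  exact ⟨L, hL, h0, fun x hx => hA x (h' hx)⟩

lemma IsAllowableTriangle.comp_affineSimplex {τ : C(stdSimplex ℝ (Fin 3), X)}
    (h : IsAllowableTriangle B τ) {v : Fin 3 → stdSimplex ℝ (Fin 3)}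
    (hv : LinearIndependent ℝ fun i => ⇑(v i)) :
    IsAllowableTriangle B (τ.comp (affineSimplex v)) where
  lines := h.lines.preimage hv
  finite := (Set.Finite.preimage (f := affineSimplex v) (affineSimplex_injective hv).injOn
    h.finite :)
  notMem _ := h.notMem _

/-- Each of the three conditions passes to images under nondegenerate affine maps and to finite
unions. -/
lemma IsAllowableTriangle.of_cover {ι : Type*} [Finite ι] {ρ : C(stdSimplex ℝ (Fin 3), X)}
    (v : ι → Fin 3 → stdSimplex ℝ (Fin 3)) (hv : ∀ i, LinearIndependent ℝ fun j => ⇑(v i j))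
    (hc : ∀ x, ∃ i y, affineSimplex (v i) y = x)
    (h : ∀ i, IsAllowableTriangle B (ρ.comp (affineSimplex (v i)))) :
    IsAllowableTriangle B ρ where
  lines := by
    refine (CoveredByLines.iUnion fun i => (h i).lines.image (hv i)).mono fun x hx => ?_
    obtain ⟨i, y, rfl⟩ := hc x
    exact Set.mem_iUnion.2 ⟨i, y, hx, rfl⟩
  finite := by
    refine (Set.finite_iUnion fun i => (h i).finite.image (affineSimplex (v i))).subset
      fun x hx => ?_
    obtain ⟨i, y, rfl⟩ := hc x
    exact Set.mem_iUnion.2 ⟨i, y, hx, rfl⟩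
  notMem x := by
    obtain ⟨i, y, rfl⟩ := hc x
    exact (h i).notMem y

lemma seg_self {l : ℕ} (x : stdSimplex ℝ (Fin l)) (t : stdSimplex ℝ (Fin 2)) : seg x x t = x := by
  apply stdSimplex.ext
  funext j
  rw [seg_apply, ← add_mul, stdSimplex.add_eq_one, one_mul]

/-- For s ≠ t the segment is injective and pulls finite sets back to finite sets. The condition on
the ends serves the case s = t, where a constant path in B 0 would not be allowable. -/
lemma IsAllowablePath.comp_seg {γ : C(stdSimplex ℝ (Fin 2), X)} (h : IsAllowablePath B γ)
    {s t : stdSimplex ℝ (Fin 2)} (hs : γ s ∉ B 0 ∨ γ t ∉ B 0) :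
    IsAllowablePath B (γ.comp (seg s t)) where
  finite := by
    rcases eq_or_ne s t with rfl | hst
    · have hs' : γ s ∉ B 0 := hs.elim id id
      refine Set.finite_empty.subset fun x hx => hs' ?_
      simpa only [Set.mem_ofPred_eq, ContinuousMap.comp_apply, seg_self] using hx
    · exact (Set.Finite.preimage (f := seg s t) (seg_injective hst).injOn h.finite :)
  notMem _ := h.notMem _

lemma IsFullPath.of_comp_seg {γ : C(stdSimplex ℝ (Fin 2), X)} (h : IsAllowablePath B γ)
    {s t : stdSimplex ℝ (Fin 2)} (hs : γ s ∉ B 0) (ht : γ t ∉ B 0) :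
    IsFullPath B (γ.comp (seg s t)) where
  toIsAllowablePath := h.comp_seg (Or.inl hs)
  zero := by simpa using hs
  one := by simpa using ht

lemma IsAllowablePath.of_halves {γ : C(stdSimplex ℝ (Fin 2), X)}
    (h : IsAllowablePath B (γ.comp (seg (vtx 0) (midpt (vtx 0) (vtx 1)))))
    (h' : IsAllowablePath B (γ.comp (seg (midpt (vtx 0) (vtx 1)) (vtx 1)))) :
    IsAllowablePath B γ where
  finite := by
    refine ((h.finite.image (seg (vtx 0) (midpt (vtx 0) (vtx 1)))).union
      (h'.finite.image (seg (midpt (vtx 0) (vtx 1)) (vtx 1)))).subset fun x hx => ?_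
    rcases exists_seg_halves x with ⟨s, rfl⟩ | ⟨s, rfl⟩
    · exact Or.inl ⟨s, hx, rfl⟩
    · exact Or.inr ⟨s, hx, rfl⟩
  notMem x := by
    rcases exists_seg_halves x with ⟨s, rfl⟩ | ⟨s, rfl⟩
    · exact h.notMem s
    · exact h'.notMem s

lemma eq_of_halves {γ γ' : C(stdSimplex ℝ (Fin 2), X)}
    (h : γ.comp (seg (vtx 0) (midpt (vtx 0) (vtx 1))) =
      γ'.comp (seg (vtx 0) (midpt (vtx 0) (vtx 1))))
    (h' : γ.comp (seg (midpt (vtx 0) (vtx 1)) (vtx 1)) =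
      γ'.comp (seg (midpt (vtx 0) (vtx 1)) (vtx 1))) : γ = γ' := by
  ext x : 1
  rcases exists_seg_halves x with ⟨s, rfl⟩ | ⟨s, rfl⟩
  · exact DFunLike.congr_fun h s
  · exact DFunLike.congr_fun h' s

/-- The preimage of B 0 consists of the fibres of an affine map Δ² → Δ¹ over finitely many
parameters q. Such a fibre is cut out by the form q₁x₀ - q₀x₁ of the image point; this form is
nonzero because some vertex is sent outside B 0, hence not to q. The triangle may be degenerate. -/
lemma IsAllowablePath.comp_affineSimplex {γ : C(stdSimplex ℝ (Fin 2), X)}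
    (h : IsAllowablePath B γ) (hB : Antitone B) {v : Fin 3 → stdSimplex ℝ (Fin 2)}
    (hv : ∃ i, γ (v i) ∉ B 0) : IsAllowableTriangle B (γ.comp (affineSimplex v)) where
  lines := by
    obtain ⟨i, hi⟩ := hv
    let f : stdSimplex ℝ (Fin 2) → (Fin 3 → ℝ) →ₗ[ℝ] ℝ := fun q =>
      (q 1 • LinearMap.proj 0 - q 0 • LinearMap.proj 1) ∘ₗ
        Fintype.linearCombination ℝ fun i => ⇑(v i)
    have hf : ∀ (q : stdSimplex ℝ (Fin 2)) (x : stdSimplex ℝ (Fin 3)), f q ⇑x = q 1 * affineSimplex v x 0 - q 0 * affineSimplex v x 1 :=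
      fun q x => rfl
    refine ⟨f '' {t | γ t ∈ B 0}, h.finite.image f, ?_, ?_⟩
    · rintro _ ⟨q, hq, rfl⟩ h0
      have h1 := hf q (vtx i)
      rw [h0, affineSimplex_vertex] at h1
      have h2 := stdSimplex.add_eq_one q
      have h3 := stdSimplex.add_eq_one (v i)
      have h4 : q = v i := by
        apply stdSimplex.ext_two
        have e1 : q 1 = 1 - q 0 := by linarith
        have e2 : v i 1 = 1 - v i 0 := by linarith
        rw [e1, e2] at h1
        change 0 = _ at h1
        linarith
      exact hi (h4 ▸ hq)
    · intro x hx
      refine ⟨_, ⟨affineSimplex v x, hx, rfl⟩, ?_⟩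
      rw [hf, mul_comm, sub_self]
  finite := Set.finite_empty.subset fun x hx => h.notMem _ hx
  notMem x hx := h.notMem _ (hB one_le_two hx)

/-- Adjacent triangles merge to one triangle, which is what makes the values of sectors additive.
The last two equations say that its edge [0,1] is the concatenation of the two outer edges. -/
lemma IsAllowableTriangle.exists_median {τ τ' : C(stdSimplex ℝ (Fin 3), X)}
    (hτ : IsAllowableTriangle B τ) (hτ' : IsAllowableTriangle B τ')
    (h : τ.comp (seg (vtx 1) (vtx 2)) = τ'.comp (seg (vtx 0) (vtx 2))) :
    ∃ ρ, IsAllowableTriangle B ρ ∧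
      ρ.comp (seg (vtx 0) (vtx 2)) = τ.comp (seg (vtx 0) (vtx 2)) ∧
      ρ.comp (seg (vtx 1) (vtx 2)) = τ'.comp (seg (vtx 1) (vtx 2)) ∧
      (ρ.comp (seg (vtx 0) (vtx 1))).comp (seg (vtx 0) (midpt (vtx 0) (vtx 1))) =
        τ.comp (seg (vtx 0) (vtx 1)) ∧
      (ρ.comp (seg (vtx 0) (vtx 1))).comp (seg (midpt (vtx 0) (vtx 1)) (vtx 1)) =
        τ'.comp (seg (vtx 0) (vtx 1)) := by
  obtain ⟨ρ, h1, h2⟩ := exists_glue_median τ τ' h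
  refine ⟨ρ, ?_, ?_, ?_, ?_, ?_⟩
  · refine IsAllowableTriangle.of_cover (ι := Bool) (fun i => cond i
      ![vtx 0, midpt (vtx 0) (vtx 1), vtx 2] ![midpt (vtx 0) (vtx 1), vtx 1, vtx 2]) ?_ ?_ ?_
    · rintro (_ | _)
      · exact linearIndependent_half_right
      · exact linearIndependent_half_left
    · intro x
      rcases exists_tri_halves x with ⟨s, hs⟩ | ⟨s, hs⟩
      · exact ⟨true, s, hs⟩
      · exact ⟨false, s, hs⟩
    · rintro (_ | _)
      · exact h2.symm ▸ hτ'
      · exact h1.symm ▸ hτ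
  · rw [← h1, comp_affineSimplex_comp_seg, tri_zero, tri_two]
  · rw [← h2, comp_affineSimplex_comp_seg, tri_one, tri_two]
  · rw [comp_affineSimplex_comp_seg, seg_zero, affineSimplex_midpt, seg_zero, seg_one, ← h1,
      comp_affineSimplex_comp_seg, tri_zero, tri_one]
  · rw [comp_affineSimplex_comp_seg, seg_one, affineSimplex_midpt, seg_zero, seg_one, ← h2,
      comp_affineSimplex_comp_seg, tri_zero, tri_one]

lemma linearIndependent_flip : LinearIndependent ℝ fun i =>
    ⇑((![vtx 1, vtx 0, vtx 2] : Fin 3 → stdSimplex ℝ (Fin 3)) i) := by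
  refine linearIndependent_three fun a b c h => ?_
  have h0 := h 0
  have h1 := h 1
  have h2 := h 2
  simp at h0 h1 h2
  exact ⟨h1, h0, h2⟩

/-- A triangle with two equal edges, folded to a triangle with these edges glued. -/
lemma IsAllowableTriangle.exists_fold {τ : C(stdSimplex ℝ (Fin 3), X)}
    (hτ : IsAllowableTriangle B τ)
    (h : τ.comp (seg (vtx 0) (vtx 2)) = τ.comp (seg (vtx 1) (vtx 2))) :
    ∃ ρ, IsAllowableTriangle B ρ ∧
      ρ.comp (seg (vtx 0) (vtx 1)) = τ.comp (seg (vtx 0) (vtx 1)) ∧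
      ρ.comp (seg (vtx 1) (vtx 2)) = τ.comp (seg (vtx 1) (vtx 0)) ∧
      ρ.comp (seg (vtx 2) (vtx 0)) = τ.comp (seg (vtx 0) (vtx 1)) := by
  -- The middle copy is flipped, so that neighbouring copies agree on their common radial edge. The
  -- boundary then reads e, the reverse of e, and e, for the edge e of τ from 0 to 1.
  let σ : Fin 3 → C(stdSimplex ℝ (Fin 3), X) :=
    ![τ, τ.comp (tri (vtx 1) (vtx 0) (vtx 2)), τ]
  have hσ : ∀ i, IsAllowableTriangle B (σ i) := by
    intro i
    fin_cases i
    · exact hτ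
    · exact hτ.comp_affineSimplex linearIndependent_flip
    · exact hτ
  have hedge : ∀ i, (σ i).comp (seg (vtx 1) (vtx 2)) = (σ (i + 1)).comp (seg (vtx 0) (vtx 2)) := by
    intro i
    have e1 : (τ.comp (tri (vtx 1) (vtx 0) (vtx 2))).comp (seg (vtx 0) (vtx 2)) =
        τ.comp (seg (vtx 1) (vtx 2)) := by
      rw [comp_affineSimplex_comp_seg, tri_zero, tri_two]
    have e2 : (τ.comp (tri (vtx 1) (vtx 0) (vtx 2))).comp (seg (vtx 1) (vtx 2)) =
        τ.comp (seg (vtx 0) (vtx 2)) := by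
      rw [comp_affineSimplex_comp_seg, tri_one, tri_two]
    fin_cases i
    · exact e1.symm
    · exact e2
    · exact h.symm
  have key : ∀ (i : Fin 3) (y y' : stdSimplex ℝ (Fin 3)), affineSimplex (radialVertices i) y =
      affineSimplex (radialVertices (i + 1)) y' → σ i y = σ (i + 1) y' := by
    intro i y y' hyy
    obtain ⟨a0, a1, a2⟩ := radial_apply i y
    obtain ⟨b0, b1, b2⟩ := radial_apply (i + 1) y'
    have e1 : i + 1 + 1 = i + 2 := by rw [add_assoc]; rfl
    have e2 : i + 1 + 2 = i := by rw [add_assoc]; exact add_zero i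
    rw [← hyy] at b0 b1 b2
    rw [e1, a2] at b1
    rw [e2, a0] at b2
    rw [a1] at b0
    have hy := stdSimplex.add_add_eq_one y
    have hy' := stdSimplex.add_add_eq_one y'
    have h0 := stdSimplex.zero_le y 0
    have h1 := stdSimplex.zero_le y 1
    have h1' := stdSimplex.zero_le y' 1
    have c0 : y 0 = 0 := by linarith
    have c1 : y' 1 = 0 := by linarith
    have d1 : y = seg (vtx 1) (vtx 2) (pointOne (y 1) h1 (stdSimplex.le_one y 1)) := by
      apply stdSimplex.ext_three <;> rw [seg_apply] <;> simp [c0]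
    have d2 : y' = seg (vtx 0) (vtx 2) (pointOne (y 1) h1 (stdSimplex.le_one y 1)) := by
      apply stdSimplex.ext_three <;> rw [seg_apply] <;> simp [c1]
      linarith
    rw [d1, d2]
    exact DFunLike.congr_fun (hedge i) _
  obtain ⟨ρ, hρ⟩ := exists_glue radialVertices exists_radial σ (by
    intro i j y y' hyy
    have hj : j = i ∨ j = i + 1 ∨ i = j + 1 := by
      clear * -
      revert i j
      decide
    rcases hj with rfl | rfl | rfl
    · exact congrArg _ (affineSimplex_injective (linearIndependent_radialVertices _) hyy)
    · exact key i y y' hyy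
    · exact (key j y' y hyy.symm).symm)
  have hedge' : ∀ i, ρ.comp (seg (vtx i) (vtx (i + 1))) = (σ i).comp (seg (vtx 0) (vtx 1)) := by
    intro i
    rw [← hρ, comp_affineSimplex_comp_seg, affineSimplex_vertex, affineSimplex_vertex]
    rfl
  refine ⟨ρ, IsAllowableTriangle.of_cover radialVertices linearIndependent_radialVertices
    exists_radial fun i => (hρ i).symm ▸ hσ i, hedge' 0, (hedge' 1).trans ?_, hedge' 2⟩
  change (τ.comp (tri (vtx 1) (vtx 0) (vtx 2))).comp (seg (vtx 0) (vtx 1)) = _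
  rw [comp_affineSimplex_comp_seg, tri_zero, tri_one]

/-! ### General position -/

/-- On the curve (1, t, t²) a nonzero form becomes a nonzero polynomial in t, so all but finitely
many t > 0 avoid every form; rescaling brings the point into the simplex. -/
lemma exists_forall_ne_zero {L : Set ((Fin 3 → ℝ) →ₗ[ℝ] ℝ)} (hL : L.Finite)
    (h0 : ∀ f ∈ L, f ≠ 0) : ∃ b : stdSimplex ℝ (Fin 3), ∀ f ∈ L, f ⇑b ≠ 0 := by
  let P : ((Fin 3 → ℝ) →ₗ[ℝ] ℝ) → Polynomial ℝ := fun f =>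
    Polynomial.C (f (Pi.single 0 1)) + Polynomial.C (f (Pi.single 1 1)) * Polynomial.X +
      Polynomial.C (f (Pi.single 2 1)) * Polynomial.X ^ 2
  have hP : ∀ f ∈ L, P f ≠ 0 := by
    intro f hf h
    refine h0 f hf (LinearMap.pi_ext' fun i => LinearMap.ext_ring ?_)
    have hc : ∀ n, (P f).coeff n = 0 := fun n => by rw [h, Polynomial.coeff_zero]
    have h0 := hc 0
    have h1 := hc 1
    have h2 := hc 2
    simp [P, Polynomial.coeff_X] at h0 h1 h2
    fin_cases i
    · exact h0
    · exact h1
    · exact h2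
  have hfin : (⋃ f ∈ L, {t | (P f).IsRoot t}).Finite :=
    hL.biUnion fun f hf => Polynomial.finite_setOfPred_isRoot (hP f hf)
  obtain ⟨t, ht, htn⟩ := (Set.Ioi_infinite (0 : ℝ)).exists_notMem_finite hfin
  have ht' : 0 < t := ht
  have hs : 0 < 1 + t + t ^ 2 := by positivity
  refine ⟨pointTwo (1 / (1 + t + t ^ 2)) (t / (1 + t + t ^ 2)) (t ^ 2 / (1 + t + t ^ 2))
    (by positivity) (by positivity) (by positivity) (by field_simp), fun f hf h => htn ?_⟩
  refine Set.mem_biUnion hf ?_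
  set b := pointTwo (1 / (1 + t + t ^ 2)) (t / (1 + t + t ^ 2)) (t ^ 2 / (1 + t + t ^ 2))
    (by positivity) (by positivity) (by positivity) (by field_simp) with hb
  have hb' : ⇑b = ∑ i, b i • (Pi.single i (1 : ℝ) : Fin 3 → ℝ) := by
    funext j
    simp [Pi.single_apply]
  rw [hb', map_sum, Fin.sum_univ_three, map_smul, map_smul, map_smul, hb, pointTwo_zero,
    pointTwo_one, pointTwo_two] at h
  have : (P f).eval t = 0 := by
    simp only [P, Polynomial.eval_add, Polynomial.eval_mul, Polynomial.eval_C, Polynomial.eval_X,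
      Polynomial.eval_pow]
    simp only [smul_eq_mul] at h
    field_simp at h
    linarith
  exact this

lemma exists_form_eq_zero (x y : Fin 3 → ℝ) : ∃ f : (Fin 3 → ℝ) →ₗ[ℝ] ℝ, f ≠ 0 ∧ f x = 0 ∧
    f y = 0 := by
  have hlt : Submodule.span ℝ {x, y} < ⊤ := by
    rw [lt_top_iff_ne_top]
    intro h
    have h1 := finrank_span_le_card (R := ℝ) ({x, y} : Set (Fin 3 → ℝ))
    rw [h, finrank_top] at h1
    have h2 : ({x, y} : Set (Fin 3 → ℝ)).toFinset.card ≤ 2 := by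
      simpa using Finset.card_le_two (a := x) (b := y)
    simp only [Module.finrank_fintype_fun_eq_card, Fintype.card_fin] at h1
    omega
  obtain ⟨f, hf, hle⟩ := Submodule.exists_le_ker_of_lt_top _ hlt
  exact ⟨f, hf, hle (Submodule.subset_span (by simp)), hle (Submodule.subset_span (by simp))⟩

instance : Infinite (stdSimplex ℝ (Fin 2)) := by
  have : Infinite (Set.Icc (0 : ℝ) 1) := (Set.Icc_infinite zero_lt_one).to_subtype
  exact Infinite.of_injective (fun a : Set.Icc (0 : ℝ) 1 => pointOne a.1 a.2.1 a.2.2)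
    fun a b h => Subtype.ext (DFunLike.congr_fun h (0 : Fin 2))

lemma IsAllowablePath.exists_notMem {γ : C(stdSimplex ℝ (Fin 2), X)} (h : IsAllowablePath B γ) :
    ∃ t, γ t ∉ B 0 := by
  obtain ⟨t, ht⟩ := h.finite.exists_notMem
  exact ⟨t, ht⟩

end Allowability

section Potential

variable {X : Type*} [TopologicalSpace X] {B : ℕ → Set X} {A : Type*} [AddCommGroup A]

/-! ### Extension of degree zero cocycles from full to allowable paths -/

/-- A path that joins two allowable paths with the same end point is allowable, and its parts are
the first path and the reverse of the second one. -/
lemma IsAllowablePath.exists_concat_reverse {β β' : C(stdSimplex ℝ (Fin 2), X)}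
    (hβ : IsAllowablePath B β) (hβ' : IsAllowablePath B β') (h0 : β (vtx 0) ∉ B 0)
    (h0' : β' (vtx 0) ∉ B 0) (h1 : β (vtx 1) = β' (vtx 1)) :
    ∃ δ, IsFullPath B δ ∧ δ.comp (seg (vtx 0) (midpt (vtx 0) (vtx 1))) = β ∧
      δ.comp (seg (vtx 1) (midpt (vtx 0) (vtx 1))) = β' := by
  obtain ⟨δ, hδ, hδ'⟩ := exists_concat β (β'.comp (seg (vtx 1) (vtx 0))) (by
    rw [ContinuousMap.comp_apply, seg_zero, h1])
  have hδ1 : δ.comp (seg (vtx 1) (midpt (vtx 0) (vtx 1))) = β' := by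
    have : (δ.comp (seg (midpt (vtx 0) (vtx 1)) (vtx 1))).comp (seg (vtx 1) (vtx 0)) =
        δ.comp (seg (vtx 1) (midpt (vtx 0) (vtx 1))) := by
      rw [comp_affineSimplex_comp_seg, seg_zero, seg_one]
    rw [← this, hδ', comp_affineSimplex_comp_seg, seg_zero, seg_one, seg_vtx,
      ContinuousMap.comp_id]
  refine ⟨δ, ⟨IsAllowablePath.of_halves (hδ.symm ▸ hβ)
    (hδ'.symm ▸ hβ'.comp_seg (Or.inr h0')), ?_, ?_⟩, hδ, hδ1⟩
  · have := DFunLike.congr_fun hδ (vtx 0)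
    rw [ContinuousMap.comp_apply, seg_zero] at this
    rwa [this]
  · have := DFunLike.congr_fun hδ1 (vtx 0)
    rw [ContinuousMap.comp_apply, seg_zero] at this
    rwa [this]

/-- The value at a bad point is that of φ at the start of any allowable path from a good point to
it. Two such paths join to a full path, so the choice does not matter. A general allowable path is
cut at a good parameter into two paths of this kind. -/
lemma exists_extension_of_forall_isFullPath (φ : X → A)
    (hφ : ∀ γ, IsFullPath B γ → φ (γ (vtx 0)) = φ (γ (vtx 1))) :
    ∃ F : X → A, (∀ x ∉ B 0, F x = φ x) ∧
      ∀ γ, IsAllowablePath B γ → F (γ (vtx 0)) = F (γ (vtx 1)) := by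
  classical
  let P : X → C(stdSimplex ℝ (Fin 2), X) → Prop := fun x β =>
    IsAllowablePath B β ∧ β (vtx 0) ∉ B 0 ∧ β (vtx 1) = x
  have hP : ∀ x β β', P x β → P x β' → φ (β (vtx 0)) = φ (β' (vtx 0)) := by
    rintro x β β' ⟨h, h0, h1⟩ ⟨h', h0', h1'⟩
    obtain ⟨δ, hδ, rfl, rfl⟩ := h.exists_concat_reverse h' h0 h0' (h1.trans h1'.symm)
    simpa only [ContinuousMap.comp_apply, seg_zero] using hφ δ hδ
  -- The default 0 concerns bad points that are not an end of any allowable path.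
  refine ⟨fun x => if x ∉ B 0 then φ x else if h : ∃ β, P x β then φ (h.choose (vtx 0)) else 0,
    fun x hx => if_pos hx, fun γ hγ => ?_⟩
  have key : ∀ β, IsAllowablePath B β → β (vtx 0) ∉ B 0 →
      (if β (vtx 1) ∉ B 0 then φ (β (vtx 1)) else
        if h : ∃ β', P (β (vtx 1)) β' then φ (h.choose (vtx 0)) else 0) = φ (β (vtx 0)) := by
    intro β hβ h0
    split_ifs with h1 h2
    · exact hP _ _ _ h2.choose_spec ⟨hβ, h0, rfl⟩
    · exact absurd ⟨β, hβ, h0, rfl⟩ h2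
    · exact (hφ β ⟨hβ, h0, h1⟩).symm
  obtain ⟨m, hm⟩ := hγ.exists_notMem
  have k0 := key (γ.comp (seg m (vtx 0))) (hγ.comp_seg (Or.inl hm)) (by simpa using hm)
  have k1 := key (γ.comp (seg m (vtx 1))) (hγ.comp_seg (Or.inl hm)) (by simpa using hm)
  simp only [ContinuousMap.comp_apply, seg_zero, seg_one] at k0 k1
  exact k0.trans k1.symm

/-! ### Extension of degree one cocycles from full to allowable triangles -/

/-- The cocycle condition on full triangles. -/
def IsFullCocycle (B : ℕ → Set X) (φ : C(stdSimplex ℝ (Fin 2), X) → A) : Prop :=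
  ∀ τ, IsFullTriangle B τ → φ (τ.comp (seg (vtx 1) (vtx 2))) - φ (τ.comp (seg (vtx 0) (vtx 2))) +
    φ (τ.comp (seg (vtx 0) (vtx 1))) = 0

lemma IsAllowablePath.isFullTriangle {γ : C(stdSimplex ℝ (Fin 2), X)}
    (h : IsAllowablePath B γ) (hB : Antitone B) {s t u : stdSimplex ℝ (Fin 2)}
    (hs : γ s ∉ B 0) (ht : γ t ∉ B 0) (hu : γ u ∉ B 0) :
    IsFullTriangle B (γ.comp (tri s t u)) where
  toIsAllowableTriangle := h.comp_affineSimplex hB ⟨0, hs⟩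
  edge01 := by
    rw [comp_affineSimplex_comp_seg, tri_zero, tri_one]
    exact IsFullPath.of_comp_seg h hs ht
  edge02 := by
    rw [comp_affineSimplex_comp_seg, tri_zero, tri_two]
    exact IsFullPath.of_comp_seg h hs hu
  edge12 := by
    rw [comp_affineSimplex_comp_seg, tri_one, tri_two]
    exact IsFullPath.of_comp_seg h ht hu

variable {φ : C(stdSimplex ℝ (Fin 2), X) → A}

/-- The triangle s, t, u inside the path is degenerate but full, so the cocycle condition applies to
it, also when parameters coincide. -/
lemma IsFullCocycle.seg_add (hφ : IsFullCocycle B φ) (hB : Antitone B)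
    {γ : C(stdSimplex ℝ (Fin 2), X)} (h : IsAllowablePath B γ) {s t u : stdSimplex ℝ (Fin 2)}
    (hs : γ s ∉ B 0) (ht : γ t ∉ B 0) (hu : γ u ∉ B 0) :
    φ (γ.comp (seg s t)) + φ (γ.comp (seg t u)) = φ (γ.comp (seg s u)) := by
  have := hφ _ (h.isFullTriangle hB hs ht hu)
  rw [comp_affineSimplex_comp_seg, comp_affineSimplex_comp_seg, comp_affineSimplex_comp_seg,
    tri_zero, tri_one, tri_two] at this
  rw [← sub_eq_zero, ← this]
  abel

lemma IsFullCocycle.seg_reverse (hφ : IsFullCocycle B φ) (hB : Antitone B)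
    {γ : C(stdSimplex ℝ (Fin 2), X)} (h : IsAllowablePath B γ) {s t : stdSimplex ℝ (Fin 2)}
    (hs : γ s ∉ B 0) (ht : γ t ∉ B 0) :
    φ (γ.comp (seg t s)) = -φ (γ.comp (seg s t)) := by
  -- Equal parameters show that φ vanishes on a constant segment at a good point.
  have h1 := hφ.seg_add hB h hs hs hs
  have h2 := hφ.seg_add hB h hs ht hs
  rw [add_eq_left.1 h1] at h2
  exact (neg_eq_of_add_eq_zero_right h2).symm

/-! ### Sectors and their potential. -/

/-- The two paths are edges with a common end point of an allowable triangle whose third edge is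
full and has value `a`. -/
def IsSector (B : ℕ → Set X) (φ : C(stdSimplex ℝ (Fin 2), X) → A)
    (β β' : C(stdSimplex ℝ (Fin 2), X)) (a : A) : Prop :=
  ∃ τ, IsAllowableTriangle B τ ∧ τ.comp (seg (vtx 0) (vtx 2)) = β ∧
    τ.comp (seg (vtx 1) (vtx 2)) = β' ∧ IsFullPath B (τ.comp (seg (vtx 0) (vtx 1))) ∧
    φ (τ.comp (seg (vtx 0) (vtx 1))) = a

lemma comp_seg_reverse {l : ℕ} (τ : C(stdSimplex ℝ (Fin l), X)) (x y : stdSimplex ℝ (Fin l)) :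
    (τ.comp (seg x y)).comp (seg (vtx 1) (vtx 0)) = τ.comp (seg y x) := by
  rw [comp_affineSimplex_comp_seg, seg_zero, seg_one]

lemma comp_seg_vtx (γ : C(stdSimplex ℝ (Fin 2), X)) : γ.comp (seg (vtx 0) (vtx 1)) = γ := by
  rw [seg_vtx, ContinuousMap.comp_id]

lemma IsFullPath.reverse {γ : C(stdSimplex ℝ (Fin 2), X)} (h : IsFullPath B γ) :
    IsFullPath B (γ.comp (seg (vtx 1) (vtx 0))) :=
  IsFullPath.of_comp_seg h.toIsAllowablePath h.one h.zero

lemma IsFullCocycle.reverse (hφ : IsFullCocycle B φ) (hB : Antitone B)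
    {γ : C(stdSimplex ℝ (Fin 2), X)} (h : IsFullPath B γ) :
    φ (γ.comp (seg (vtx 1) (vtx 0))) = -φ γ := by
  have := hφ.seg_reverse hB h.toIsAllowablePath h.zero h.one
  rwa [comp_seg_vtx] at this

lemma IsFullPath.of_halves {γ : C(stdSimplex ℝ (Fin 2), X)}
    (h : IsFullPath B (γ.comp (seg (vtx 0) (midpt (vtx 0) (vtx 1)))))
    (h' : IsFullPath B (γ.comp (seg (midpt (vtx 0) (vtx 1)) (vtx 1)))) : IsFullPath B γ where
  toIsAllowablePath := IsAllowablePath.of_halves h.toIsAllowablePath h'.toIsAllowablePath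
  zero := by simpa using h.zero
  one := by simpa using h'.one

lemma IsFullCocycle.halves (hφ : IsFullCocycle B φ) (hB : Antitone B)
    {γ : C(stdSimplex ℝ (Fin 2), X)}
    (h : IsFullPath B (γ.comp (seg (vtx 0) (midpt (vtx 0) (vtx 1)))))
    (h' : IsFullPath B (γ.comp (seg (midpt (vtx 0) (vtx 1)) (vtx 1)))) :
    φ γ = φ (γ.comp (seg (vtx 0) (midpt (vtx 0) (vtx 1)))) +
      φ (γ.comp (seg (midpt (vtx 0) (vtx 1)) (vtx 1))) := by
  have hγ := IsFullPath.of_halves h h'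
  rw [hφ.seg_add hB hγ.toIsAllowablePath hγ.zero (by simpa using h.one) hγ.one, comp_seg_vtx]

/-- Merged along the common side, the two sectors form one whose third edge is the concatenation of
the old ones, and φ is additive on it. -/
lemma IsSector.trans (hφ : IsFullCocycle B φ) (hB : Antitone B)
    {β β' β'' : C(stdSimplex ℝ (Fin 2), X)} {a a' : A} (h : IsSector B φ β β' a)
    (h' : IsSector B φ β' β'' a') : IsSector B φ β β'' (a + a') := by
  obtain ⟨τ, hτ, rfl, h12, hf, rfl⟩ := h
  obtain ⟨τ', hτ', h02', rfl, hf', rfl⟩ := h'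
  obtain ⟨ρ, hρ, e02, e12, e01, e01'⟩ := hτ.exists_median hτ' (h12.trans h02'.symm)
  rw [← e01] at hf ⊢
  rw [← e01'] at hf' ⊢
  exact ⟨ρ, hρ, e02, e12, IsFullPath.of_halves hf hf', hφ.halves hB hf hf'⟩

lemma IsSector.symm (hφ : IsFullCocycle B φ) (hB : Antitone B)
    {β β' : C(stdSimplex ℝ (Fin 2), X)} {a : A} (h : IsSector B φ β β' a) :
    IsSector B φ β' β (-a) := by
  obtain ⟨τ, hτ, rfl, rfl, hf, rfl⟩ := h
  have e : (τ.comp (tri (vtx 1) (vtx 0) (vtx 2))).comp (seg (vtx 0) (vtx 1)) =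
      (τ.comp (seg (vtx 0) (vtx 1))).comp (seg (vtx 1) (vtx 0)) := by
    rw [comp_affineSimplex_comp_seg, tri_zero, tri_one, comp_seg_reverse]
  refine ⟨_, hτ.comp_affineSimplex linearIndependent_flip, ?_, ?_, ?_, ?_⟩
  · rw [comp_affineSimplex_comp_seg, tri_zero, tri_two]
  · rw [comp_affineSimplex_comp_seg, tri_one, tri_two]
  · rw [e]
    exact hf.reverse
  · rw [e, hφ.reverse hB hf]

/-- The folded triangle is full with boundary e, reverse of e, e. The cocycle condition becomes -a +
a + a = 0. -/
lemma IsSector.eq_zero (hφ : IsFullCocycle B φ) (hB : Antitone B)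
    {β : C(stdSimplex ℝ (Fin 2), X)} {a : A} (h : IsSector B φ β β a) : a = 0 := by
  obtain ⟨τ, hτ, h02, h12, hf, rfl⟩ := h
  obtain ⟨ρ, hρ, e01, e12, e20⟩ := hτ.exists_fold (h02.trans h12.symm)
  replace e12 := e12.trans (comp_seg_reverse τ _ _).symm
  have e02 : ρ.comp (seg (vtx 0) (vtx 2)) =
      (τ.comp (seg (vtx 0) (vtx 1))).comp (seg (vtx 1) (vtx 0)) := by
    rw [← e20, comp_seg_reverse]
  have := hφ ρ ⟨hρ, e01 ▸ hf, e02 ▸ hf.reverse, e12 ▸ hf.reverse⟩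
  rwa [e01, e02, e12, hφ.reverse hB hf, sub_self, zero_add] at this

/-- Paths linked by sectors form classes. Closed chains of sectors have total value zero, so the
value of a sector to a fixed representative of the class is well defined and serves as the
potential. -/
lemma IsFullCocycle.exists_potential (hφ : IsFullCocycle B φ) (hB : Antitone B) :
    ∃ Ψ : C(stdSimplex ℝ (Fin 2), X) → A, ∀ β β' a, IsSector B φ β β' a → Ψ β = a + Ψ β' := by
  classical
  let r : Setoid C(stdSimplex ℝ (Fin 2), X) :=
    { r := fun β β' => β = β' ∨ ∃ a, IsSector B φ β β' a
      iseqv :=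
        { refl := fun β => Or.inl rfl
          symm := by
            rintro β β' (rfl | ⟨a, ha⟩)
            · exact Or.inl rfl
            · exact Or.inr ⟨_, ha.symm hφ hB⟩
          trans := by
            rintro β β' β'' (rfl | ⟨a, ha⟩) h
            · exact h
            · rcases h with rfl | ⟨a', ha'⟩
              · exact Or.inr ⟨a, ha⟩
              · exact Or.inr ⟨_, ha.trans hφ hB ha'⟩ } }
  let rep : C(stdSimplex ℝ (Fin 2), X) → C(stdSimplex ℝ (Fin 2), X) :=
    fun β => (Quotient.mk r β).out
  have hrep : ∀ β β' a, IsSector B φ β β' a → ∃ c, IsSector B φ β (rep β) c := by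
    intro β β' a ha
    rcases Quotient.exact (Quotient.out_eq (Quotient.mk r β)) with h | ⟨c, hc⟩
    -- Equality with the representative provides no sector by itself; one is obtained by going to β'
    -- and back.
    · exact ⟨a + -a, by
        change IsSector B φ β (Quotient.mk r β).out (a + -a)
        rw [h]
        exact ha.trans hφ hB (ha.symm hφ hB)⟩
    · exact ⟨_, hc.symm hφ hB⟩
  refine ⟨fun β => if h : ∃ c, IsSector B φ β (rep β) c then h.choose else 0,
    fun β β' a ha => ?_⟩
  have h := hrep β β' a ha
  have h' := hrep β' β _ (ha.symm hφ hB)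
  have e : rep β' = rep β :=
    congrArg Quotient.out (Quotient.sound (s := r) (Or.inr ⟨_, ha.symm hφ hB⟩))
  simp only [dif_pos h, dif_pos h']
  have s1 := h.choose_spec
  have s2 := h'.choose_spec
  have s2' : IsSector B φ β' (rep β) h'.choose := Eq.subst (motive := fun γ =>
    IsSector B φ β' γ h'.choose) e s2
  have := ((s1.trans hφ hB (s2'.symm hφ hB)).trans hφ hB (ha.symm hφ hB)).eq_zero hφ hB
  rw [← sub_eq_zero, ← this]
  abel

/-! ### Points in general position in an allowable triangle. -/

/-- A point `b` in general position with respect to an allowable triangle and two points `v`, `w`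
of its domain. -/
structure IsInGeneralPosition (B : ℕ → Set X) (τ : C(stdSimplex ℝ (Fin 3), X))
    (b v w : stdSimplex ℝ (Fin 3)) : Prop where
  allowable : IsAllowableTriangle B τ
  linearIndependent : LinearIndependent ℝ fun i =>
    ⇑((![b, v, w] : Fin 3 → stdSimplex ℝ (Fin 3)) i)
  generic : ∃ L : Set ((Fin 3 → ℝ) →ₗ[ℝ] ℝ), L.Finite ∧ (∀ f ∈ L, f ⇑b ≠ 0) ∧
    ∀ x, τ x ∈ B 0 → ∃ f ∈ L, f ⇑x = 0
  left : ∀ t, τ (seg b v t) ∈ B 1 → t = vtx 1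
  right : ∀ t, τ (seg b w t) ∈ B 1 → t = vtx 1

lemma vtx_eq_of_zero_eq_zero {t : stdSimplex ℝ (Fin 2)} (h : t 0 = 0) : t = vtx 1 :=
  stdSimplex.ext_two (by simpa using h)

lemma vtx_eq_of_one_eq_zero {t : stdSimplex ℝ (Fin 2)} (h : t 1 = 0) : t = vtx 0 :=
  stdSimplex.ext_two (by
    have := stdSimplex.add_eq_one t
    simp
    linarith)

/-- The point is taken off finitely many lines: those that cover the preimage of B 0, those through
a vertex and a point over B 1, and the three sides. The second family keeps each segment from b to a
vertex off B 1 except perhaps at the vertex; the third makes b independent of any two vertices. -/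
lemma IsAllowableTriangle.exists_isInGeneralPosition {τ : C(stdSimplex ℝ (Fin 3), X)}
    (h : IsAllowableTriangle B τ) :
    ∃ b, ∀ i j : Fin 3, i ≠ j → IsInGeneralPosition B τ b (vtx i) (vtx j) := by
  obtain ⟨L, hL, h0, hA⟩ := h.lines
  choose f hf0 hfx hfy using fun x : stdSimplex ℝ (Fin 3) × Fin 3 =>
    exists_form_eq_zero ⇑x.1 ⇑(vtx x.2 : stdSimplex ℝ (Fin 3))
  obtain ⟨b, hb⟩ := exists_forall_ne_zero
    (L := (L ∪ f '' ({t | τ t ∈ B 1} ×ˢ Set.univ)) ∪ Set.range LinearMap.proj)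
    ((hL.union ((h.finite.prod Set.finite_univ).image f)).union (Set.finite_range _)) (by
      rintro g ((hg | ⟨x, -, rfl⟩) | ⟨i, rfl⟩)
      · exact h0 g hg
      · exact hf0 x
      · intro h
        have := DFunLike.congr_fun h (Pi.single i 1 : Fin 3 → ℝ)
        simp at this)
  have hprobe : ∀ i t, τ (seg b (vtx i) t) ∈ B 1 → t = vtx 1 := by
    intro i t ht
    have h1 := hfx (seg b (vtx i) t, i)
    rw [map_affineSimplex, Fin.sum_univ_two] at h1
    change t 0 * f (seg b (vtx i) t, i) b + t 1 * f (seg b (vtx i) t, i) (vtx i) = 0 at h1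
    rw [hfy (seg b (vtx i) t, i), mul_zero, add_zero] at h1
    refine vtx_eq_of_zero_eq_zero ((mul_eq_zero.1 h1).resolve_right ?_)
    exact hb _ (Or.inl (Or.inr ⟨(seg b (vtx i) t, i), ⟨ht, Set.mem_univ _⟩, rfl⟩))
  refine ⟨b, fun i j hij => ⟨h, ?_, ⟨L, hL, fun f hf => hb f (Or.inl (Or.inl hf)), hA⟩,
    hprobe i, hprobe j⟩⟩
  refine linearIndependent_three fun a c d hacd => ?_
  have hbk : ∀ k, b k ≠ 0 := fun k => hb (LinearMap.proj k) (Or.inr ⟨k, rfl⟩)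
  have ha : a = 0 := by
    obtain ⟨k, hki, hkj⟩ : ∃ k, k ≠ i ∧ k ≠ j := by
      clear * -
      revert i j
      decide
    have := hacd k
    simp [hki, hkj] at this
    exact this.resolve_right (hbk k)
  refine ⟨ha, ?_, ?_⟩
  · simpa [ha, hij] using hacd i
  · simpa [ha, hij.symm] using hacd j

namespace IsInGeneralPosition

variable {τ : C(stdSimplex ℝ (Fin 3), X)} {b v w : stdSimplex ℝ (Fin 3)}

lemma swap (h : IsInGeneralPosition B τ b v w) : IsInGeneralPosition B τ b w v where
  allowable := h.allowable
  linearIndependent := linearIndependent_three fun a c d hacd => by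
    obtain ⟨h1, h2, h3⟩ := h.linearIndependent.three_eq_zero (a := a) (b := d) (c := c)
      fun j => by
        rw [← hacd j]
        ring
    exact ⟨h1, h3, h2⟩
  generic := h.generic
  left := h.right
  right := h.left

lemma notMem (h : IsInGeneralPosition B τ b v w) : τ b ∉ B 0 := by
  obtain ⟨L, -, hb, hL⟩ := h.generic
  intro hx
  obtain ⟨f, hf, hfx⟩ := hL b hx
  exact hb f hf hfx

/-- A form that does not vanish at b vanishes at most once on a segment issued from b, so B 0 is met
finitely often and only B 1 remains to be excluded. -/
lemma isAllowablePath (h : IsInGeneralPosition B τ b v w) {x : stdSimplex ℝ (Fin 3)}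
    (hx : ∀ t, τ (seg b x t) ∉ B 1) : IsAllowablePath B (τ.comp (seg b x)) where
  finite := by
    obtain ⟨L, hL, hb, hA⟩ := h.generic
    refine (hL.biUnion (t := fun f => {t | f (seg b x t) = 0}) fun f hf => ?_).subset
      fun t ht => ?_
    · refine Set.Subsingleton.finite fun s hs t ht => stdSimplex.ext_two ?_
      rw [Set.mem_ofPred_eq, map_affineSimplex, Fin.sum_univ_two] at hs ht
      change s 0 * f b + s 1 * f x = 0 at hs
      change t 0 * f b + t 1 * f x = 0 at ht
      have h1 := stdSimplex.add_eq_one s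
      have h2 := stdSimplex.add_eq_one t
      have e1 : s 1 = 1 - s 0 := by linarith
      have e2 : t 1 = 1 - t 0 := by linarith
      have h3 : (s 0 - t 0) * f b = 0 := by
        rw [e1] at hs
        rw [e2] at ht
        linear_combination (1 - t 0) * hs - (1 - s 0) * ht
      have := (mul_eq_zero.1 h3).resolve_right (hb f hf)
      linarith
    · obtain ⟨f, hf, hft⟩ := hA _ ht
      exact Set.mem_biUnion hf hft
  notMem := hx

lemma isFullPath (h : IsInGeneralPosition B τ b v w) (hB : Antitone B) (hv : τ v ∉ B 0) :
    IsFullPath B (τ.comp (seg b v)) where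
  toIsAllowablePath := h.isAllowablePath fun t ht => by
    obtain rfl := h.left t ht
    rw [seg_one] at ht
    exact hv (hB zero_le_one ht)
  zero := by simpa using h.notMem
  one := by simpa using hv

/-- Each of the finitely many points over B 1 differs from b, hence lies on at most one ray from b
to the edge. -/
lemma finite_crossing (h : IsInGeneralPosition B τ b v w) (hB : Antitone B) :
    {s | ∃ t, τ (seg b (seg v w s) t) ∈ B 1}.Finite := by
  refine (h.allowable.finite.biUnion (t := fun q => {s | ∃ t, seg b (seg v w s) t = q})
    fun q hq => ?_).subset ?_
  · refine Set.Subsingleton.finite ?_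
    rintro s ⟨t, rfl⟩ s' ⟨t', ht'⟩
    obtain ⟨h1, h2, h3⟩ := h.linearIndependent.three_eq_zero (a := t' 0 - t 0)
      (b := t' 1 * s' 0 - t 1 * s 0) (c := t' 1 * s' 1 - t 1 * s 1) fun j => by
        have := DFunLike.congr_fun ht' j
        rw [seg_apply, seg_apply, seg_apply, seg_apply] at this
        linear_combination this
    have e := stdSimplex.add_eq_one t
    have e' := stdSimplex.add_eq_one t'
    have h4 : t' 1 = t 1 := by linarith
    rw [h4, ← mul_sub] at h2
    rcases mul_eq_zero.1 h2 with h5 | h5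
    · refine absurd (hB zero_le_one hq) ?_
      rw [vtx_eq_of_one_eq_zero h5, seg_zero]
      exact h.notMem
    · exact stdSimplex.ext_two (by linarith)
  · rintro s ⟨t, ht⟩
    exact Set.mem_biUnion (show seg b (seg v w s) t ∈ _ from ht) ⟨t, rfl⟩

lemma linearIndependent_left (h : IsInGeneralPosition B τ b v w) {s : stdSimplex ℝ (Fin 2)}
    (hs : s 1 ≠ 0) : LinearIndependent ℝ fun i =>
      ⇑((![b, seg v w s, v] : Fin 3 → stdSimplex ℝ (Fin 3)) i) := by
  refine linearIndependent_three fun a c d hacd => ?_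
  obtain ⟨h1, h2, h3⟩ := h.linearIndependent.three_eq_zero (a := a) (b := c * s 0 + d)
    (c := c * s 1) fun j => by
      rw [← hacd j, seg_apply]
      ring
  have hc := (mul_eq_zero.1 h3).resolve_right hs
  refine ⟨h1, hc, ?_⟩
  simpa [hc] using h2

lemma seg_swap (s : stdSimplex ℝ (Fin 2)) :
    seg v w s = seg w v (seg (vtx 1) (vtx 0) s) := by
  rw [← ContinuousMap.comp_apply, affineSimplex_comp_seg, seg_zero, seg_one]

lemma linearIndependent_reorder {x y z : stdSimplex ℝ (Fin 3)}
    (h : LinearIndependent ℝ fun i => ⇑((![x, y, z] : Fin 3 → stdSimplex ℝ (Fin 3)) i)) :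
    LinearIndependent ℝ fun i => ⇑((![y, x, z] : Fin 3 → stdSimplex ℝ (Fin 3)) i) := by
  refine linearIndependent_three fun a c d hacd => ?_
  obtain ⟨h1, h2, h3⟩ := h.three_eq_zero (a := c) (b := a) (c := d) fun j => by
    rw [← hacd j]
    ring
  exact ⟨h2, h1, h3⟩

/-- The triangles b, s, v and s, b', v' share the side from the crossing point s to the vertex.
Merged along it they have α as third edge; s ≠ v keeps them nondegenerate. -/
lemma isSector_of_crossing {A : Type*} {φ : C(stdSimplex ℝ (Fin 2), X) → A}
    (h : IsInGeneralPosition B τ b v w)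
    {τ' : C(stdSimplex ℝ (Fin 3), X)} {b' v' w' : stdSimplex ℝ (Fin 3)}
    (h' : IsInGeneralPosition B τ' b' v' w') (he : τ.comp (seg v w) = τ'.comp (seg v' w'))
    {s : stdSimplex ℝ (Fin 2)} (hs : s 1 ≠ 0) {α : C(stdSimplex ℝ (Fin 2), X)}
    (hα : IsFullPath B α)
    (h1 : α.comp (seg (vtx 0) (midpt (vtx 0) (vtx 1))) = τ.comp (seg b (seg v w s)))
    (h2 : α.comp (seg (midpt (vtx 0) (vtx 1)) (vtx 1)) = τ'.comp (seg (seg v' w' s) b')) :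
    IsSector B φ (τ.comp (seg b v)) (τ'.comp (seg b' v')) (φ α) := by
  have hm : (τ.comp (tri b (seg v w s) v)).comp (seg (vtx 1) (vtx 2)) =
      (τ'.comp (tri (seg v' w' s) b' v')).comp (seg (vtx 0) (vtx 2)) := by
    have := congrArg (fun γ => γ.comp (seg s (vtx 0))) he
    simp only [comp_affineSimplex_comp_seg, seg_zero] at this
    rw [comp_affineSimplex_comp_seg, comp_affineSimplex_comp_seg, tri_zero, tri_one, tri_two,
      tri_two, this]
  obtain ⟨ρ, hρ, e02, e12, e01, e01'⟩ :=
    (h.allowable.comp_affineSimplex (h.linearIndependent_left hs)).exists_median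
      (h'.allowable.comp_affineSimplex
        (linearIndependent_reorder (h'.linearIndependent_left hs))) hm
  have hρα : ρ.comp (seg (vtx 0) (vtx 1)) = α := by
    refine eq_of_halves ?_ ?_
    · rw [e01, h1, comp_affineSimplex_comp_seg, tri_zero, tri_one]
    · rw [e01', h2, comp_affineSimplex_comp_seg, tri_zero, tri_one]
  refine ⟨ρ, hρ, ?_, ?_, hρα ▸ hα, by rw [hρα]⟩
  · rw [e02, comp_affineSimplex_comp_seg, tri_zero, tri_two]
  · rw [e12, comp_affineSimplex_comp_seg, tri_one, tri_two]

/-- Generic points of two triangles with a common edge are joined by a path that crosses the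
edge, and the two triangles divide along it. -/
lemma exists_isSector {A : Type*} {φ : C(stdSimplex ℝ (Fin 2), X) → A}
    (h : IsInGeneralPosition B τ b v w) (hB : Antitone B)
    {τ' : C(stdSimplex ℝ (Fin 3), X)} {b' v' w' : stdSimplex ℝ (Fin 3)}
    (h' : IsInGeneralPosition B τ' b' v' w') (he : τ.comp (seg v w) = τ'.comp (seg v' w')) :
    ∃ a, IsSector B φ (τ.comp (seg b v)) (τ'.comp (seg b' v')) a ∧
      IsSector B φ (τ.comp (seg b w)) (τ'.comp (seg b' w')) a := by
  -- The crossing point avoids the finitely many rays of either triangle that meet B 1, and both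
  -- ends of the edge.
  obtain ⟨s, hs⟩ := (((h.finite_crossing hB).union (h'.finite_crossing hB)).union
    (Set.toFinite {vtx 0, vtx 1})).exists_notMem
  simp only [Set.mem_union, Set.mem_ofPred_eq, not_or, not_exists, Set.mem_insert_iff,
    Set.mem_singleton_iff] at hs
  obtain ⟨⟨hs1, hs2⟩, hs3, hs4⟩ := hs
  have hp := h.isAllowablePath hs1
  have hp' := h'.isAllowablePath hs2
  have hmid : (τ.comp (seg b (seg v w s))) (vtx 1) = (τ'.comp (seg b' (seg v' w' s))) (vtx 1) := by
    simpa using DFunLike.congr_fun he s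
  obtain ⟨α, hα, h1, h2⟩ := hp.exists_concat_reverse hp' (by simpa using h.notMem)
    (by simpa using h'.notMem) hmid
  have h2' : α.comp (seg (midpt (vtx 0) (vtx 1)) (vtx 1)) = τ'.comp (seg (seg v' w' s) b') := by
    rw [← comp_seg_reverse, h2, comp_seg_reverse]
  have he' : τ.comp (seg w v) = τ'.comp (seg w' v') := by
    rw [← comp_seg_reverse, he, comp_seg_reverse]
  refine ⟨φ α, h.isSector_of_crossing h' he (fun hz => hs3 (vtx_eq_of_one_eq_zero hz)) hα h1 h2',
    ?_⟩
  -- The same α serves at the other end, with the edge and the parameter reversed; hence the common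
  -- value `a`.
  refine h.swap.isSector_of_crossing h'.swap he' (s := seg (vtx 1) (vtx 0) s) ?_ hα ?_ ?_
  · rw [seg_apply]
    simpa using fun hz => hs4 (vtx_eq_of_zero_eq_zero hz)
  · rw [← seg_swap, h1]
  · rw [← seg_swap, h2']

end IsInGeneralPosition

/-- The value of an edge is a difference of Ψ along two probes from a generic point of any allowable
triangle that carries the edge. The edge itself need not be allowable, so only the probes and their
sectors are used. -/
lemma IsFullCocycle.exists_extension (hφ : IsFullCocycle B φ) (hB : Antitone B) :
    ∃ F : C(stdSimplex ℝ (Fin 2), X) → A, (∀ γ, IsFullPath B γ → F γ = φ γ) ∧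
      ∀ τ, IsAllowableTriangle B τ →
        F (τ.comp (seg (vtx 1) (vtx 2))) - F (τ.comp (seg (vtx 0) (vtx 2))) +
          F (τ.comp (seg (vtx 0) (vtx 1))) = 0 := by
  classical
  obtain ⟨Ψ₀, hΨ₀⟩ := hφ.exists_potential hB
  obtain ⟨Ψ, hΨ⟩ : ∃ Ψ : C(stdSimplex ℝ (Fin 2), X) → A, ∀ β,
      Ψ β = if IsFullPath B β then φ β else Ψ₀ β := ⟨_, fun _ => rfl⟩
  -- Ψ uses φ on full paths and the potential elsewhere, and these normalisations need not match; so
  -- both sides must be full or neither. This holds in the application, where fullness of a probe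
  -- depends only on its common end point.
  have hsec : ∀ β β' a, IsSector B φ β β' a → (IsFullPath B β ↔ IsFullPath B β') →
      Ψ β = a + Ψ β' := by
    intro β β' a ha hββ
    rw [hΨ, hΨ]
    by_cases h : IsFullPath B β
    · rw [if_pos h, if_pos (hββ.1 h)]
      obtain ⟨τ, hτ, rfl, rfl, hf, rfl⟩ := ha
      have := hφ τ ⟨hτ, hf, h, hββ.1 h⟩
      rw [← sub_eq_zero, ← neg_eq_zero, ← this]
      abel
    · rw [if_neg h, if_neg fun h' => h (hββ.2 h')]
      exact hΨ₀ _ _ _ ha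
  have hiff : ∀ {τ b v w}, IsInGeneralPosition B τ b v w →
      (IsFullPath B (τ.comp (seg b v)) ↔ τ v ∉ B 0) := fun h =>
    ⟨fun h' => by simpa using h'.one, h.isFullPath hB⟩
  let P : C(stdSimplex ℝ (Fin 2), X) → A → Prop := fun e a => ∃ τ b v w,
    IsInGeneralPosition B τ b v w ∧ τ.comp (seg v w) = e ∧
      a = Ψ (τ.comp (seg b w)) - Ψ (τ.comp (seg b v))
  have hP : ∀ e a a', P e a → P e a' → a = a' := by
    rintro e a a' ⟨τ, b, v, w, h, rfl, rfl⟩ ⟨τ', b', v', w', h', he, rfl⟩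
    have hv : τ v = τ' v' := by simpa using DFunLike.congr_fun he.symm (vtx 0)
    have hw : τ w = τ' w' := by simpa using DFunLike.congr_fun he.symm (vtx 1)
    obtain ⟨c, h1, h2⟩ := h.exists_isSector (φ := φ) hB h' he.symm
    rw [hsec _ _ _ h1 (by rw [hiff h, hiff h', hv]),
      hsec _ _ _ h2 (by rw [hiff h.swap, hiff h'.swap, hw])]
    abel
  have hF : ∀ e, ∃ a, (IsFullPath B e → a = φ e) ∧ ∀ a', P e a' → a = a' := by
    intro e
    by_cases hex : ∃ a, P e a
    · obtain ⟨a, ha⟩ := hex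
      refine ⟨a, fun he => ?_, fun a' ha' => hP e a a' ha ha'⟩
      obtain ⟨τ, b, v, w, h, rfl, rfl⟩ := ha
      have hv : τ v ∉ B 0 := by simpa using he.zero
      have hw : τ w ∉ B 0 := by simpa using he.one
      have h1 := h.isFullPath hB hv
      have h2 := h.swap.isFullPath hB hw
      rw [hΨ, hΨ, if_pos h1, if_pos h2]
      have := hφ (τ.comp (tri b v w)) ⟨h.allowable.comp_affineSimplex h.linearIndependent,
        by rwa [comp_affineSimplex_comp_seg, tri_zero, tri_one],
        by rwa [comp_affineSimplex_comp_seg, tri_zero, tri_two],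
        by rwa [comp_affineSimplex_comp_seg, tri_one, tri_two]⟩
      rw [comp_affineSimplex_comp_seg, comp_affineSimplex_comp_seg, comp_affineSimplex_comp_seg,
        tri_zero, tri_one, tri_two] at this
      rw [← sub_eq_zero, ← neg_eq_zero, ← this]
      abel
    -- A path with no triangle attached is constrained only by the requirement to extend φ.
    · exact ⟨φ e, fun _ => rfl, fun a' ha' => absurd ⟨a', ha'⟩ hex⟩
  choose F hF1 hF2 using hF
  refine ⟨F, hF1, fun τ hτ => ?_⟩
  obtain ⟨b, hb⟩ := hτ.exists_isInGeneralPosition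
  have hedge : ∀ i j : Fin 3, i ≠ j → F (τ.comp (seg (vtx i) (vtx j))) =
      Ψ (τ.comp (seg b (vtx j))) - Ψ (τ.comp (seg b (vtx i))) := fun i j hij =>
    hF2 _ _ ⟨τ, b, _, _, hb i j hij, rfl, rfl⟩
  rw [hedge 1 2 (by decide), hedge 0 2 (by decide), hedge 0 1 (by decide)]
  abel

end Potential

/-! ### Polyhedral dimension of subsets of simplices of dimension at most two -/

lemma ExtInt.ofInt_le_ofInt {a b : ℤ} : ExtInt.ofInt a ≤ ExtInt.ofInt b ↔ a ≤ b :=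
  WithBot.coe_le_coe.trans WithTop.coe_le_coe

lemma ExtInt.ofInt_lt_ofInt {a b : ℤ} : ExtInt.ofInt a < ExtInt.ofInt b ↔ a < b :=
  WithBot.coe_lt_coe.trans WithTop.coe_lt_coe

/-- Infinite values absorb the shift: both sides are true at -∞ and false at +∞. -/
lemma ExtInt.ofInt_add_lt_iff (z k : ℤ) (q : ExtInt) :
    ExtInt.ofInt (z + k) + q < ExtInt.ofInt k ↔ ExtInt.ofInt z + q < 0 := by
  induction q using WithBot.recBotCoe with
  | bot => simp [WithBot.bot_lt_iff_ne_bot, ExtInt.ofInt]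
  | coe q =>
    induction q using WithTop.recTopCoe with
    | top =>
      have h : ∀ a, ¬ ExtInt.ofInt a + ((⊤ : WithTop ℤ) : ExtInt) < ExtInt.ofInt k := by
        intro a h
        have : ExtInt.ofInt a + ((⊤ : WithTop ℤ) : ExtInt) = ((⊤ : WithTop ℤ) : ExtInt) := rfl
        rw [this] at h
        exact not_top_lt (WithBot.coe_lt_coe.1 h)
      have h' : ¬ ExtInt.ofInt z + ((⊤ : WithTop ℤ) : ExtInt) < 0 := by
        intro h
        exact not_top_lt (WithBot.coe_lt_coe.1 h)
      exact iff_of_false (h _) h'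
    | coe q =>
      change ExtInt.ofInt (z + k + q) < ExtInt.ofInt k ↔ ExtInt.ofInt (z + q) < ExtInt.ofInt 0
      rw [ExtInt.ofInt_lt_ofInt, ExtInt.ofInt_lt_ofInt]
      omega

lemma cellDim_nonneg {k : ℕ} (T : Finset (Fin k → ℝ)) : 0 ≤ cellDim T := Int.natCast_nonneg _

section PolyDim

variable {k : ℕ} {b : ExtInt}

lemma PolyDimLE.empty : PolyDimLE (∅ : Set (stdSimplex ℝ (Fin k))) b :=
  ⟨∅, by simp, by simp⟩

lemma PolyDimLE.eq_empty {A : Set (stdSimplex ℝ (Fin k))} (h : PolyDimLE A b) (hb : b < 0) :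
    A = ∅ := by
  obtain ⟨Q, hQ, hA⟩ := h
  refine Set.eq_empty_of_forall_notMem fun x hx => ?_
  obtain ⟨T, hT, -⟩ := hA x hx
  have h := ((hQ T hT).2.trans_lt hb)
  exact absurd (ExtInt.ofInt_lt_ofInt.1 h) (cellDim_nonneg T).not_gt

lemma PolyDimLE.finite {A : Set (stdSimplex ℝ (Fin k))} (h : PolyDimLE A b)
    (hb : b < ExtInt.ofInt 1) : A.Finite := by
  obtain ⟨Q, hQ, hA⟩ := h
  have hfin : (⋃ T ∈ Q, convexHull ℝ (T : Set (Fin k → ℝ))).Finite := by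
    refine Q.finite_toSet.biUnion fun T hT => ?_
    have h := ExtInt.ofInt_lt_ofInt.1 ((hQ T hT).2.trans_lt hb)
    have h0 : vectorSpan ℝ (T : Set (Fin k → ℝ)) = ⊥ := by
      rw [← Submodule.finrank_eq_zero (R := ℝ)]
      unfold cellDim at h
      omega
    rw [vectorSpan_eq_bot_iff_subsingleton] at h0
    rw [h0.convex.convexHull_eq]
    exact T.finite_toSet
  refine (hfin.preimage Subtype.val_injective.injOn).subset fun x hx => ?_
  obtain ⟨T, hT, hxT⟩ := hA x hx
  exact Set.mem_biUnion hT hxT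

lemma PolyDimLE.of_finite {A : Set (stdSimplex ℝ (Fin k))} (h : A.Finite)
    (hb : ExtInt.ofInt 0 ≤ b) : PolyDimLE A b := by
  classical
  refine ⟨h.toFinset.image fun x : stdSimplex ℝ (Fin k) => ({⇑x} : Finset (Fin k → ℝ)), ?_, fun x hx =>
    ⟨({⇑x} : Finset (Fin k → ℝ)), Finset.mem_image_of_mem _ (h.mem_toFinset.2 hx), by simp⟩⟩
  intro T hT
  obtain ⟨x, -, rfl⟩ := Finset.mem_image.1 hT
  refine ⟨Finset.singleton_nonempty _, ?_⟩
  have : cellDim ({⇑x} : Finset (Fin k → ℝ)) = 0 := by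
    rw [cellDim, Finset.coe_singleton, vectorSpan_singleton, finrank_bot]
    rfl
  rwa [this]

lemma PolyDimLE.of_le (A : Set (stdSimplex ℝ (Fin (k + 1)))) (hb : ExtInt.ofInt k ≤ b) :
    PolyDimLE A b := by
  classical
  refine ⟨{Finset.univ.image fun i => Pi.single i 1}, ?_, fun x _ =>
    ⟨_, Finset.mem_singleton_self _, ?_⟩⟩
  · intro T hT
    rw [Finset.mem_singleton] at hT
    subst hT
    refine ⟨Finset.univ_nonempty.image _, le_trans (ExtInt.ofInt_le_ofInt.2 ?_) hb⟩
    have := finrank_vectorSpan_image_finset_le ℝ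
      (fun i => Pi.single i 1 : Fin (k + 1) → Fin (k + 1) → ℝ) Finset.univ (n := k) (by simp)
    unfold cellDim
    exact_mod_cast this
  · rw [Finset.coe_image, Finset.coe_univ, Set.image_univ,
      convexHull_rangle_single_eq_stdSimplex]
    exact x.2

/-- A cell of dimension at most 1, seen in ℝ³, spans together with the origin a linear subspace of
dimension at most 2, on which some nonzero form vanishes. -/
lemma PolyDimLE.coveredByLines {A : Set (stdSimplex ℝ (Fin 3))} (h : PolyDimLE A b)
    (hb : b < ExtInt.ofInt 2) : CoveredByLines A := by
  classical
  obtain ⟨Q, hQ, hA⟩ := h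
  have key : ∀ T : Q, ∃ f : (Fin 3 → ℝ) →ₗ[ℝ] ℝ, f ≠ 0 ∧
      ∀ x ∈ convexHull ℝ (T.1 : Set (Fin 3 → ℝ)), f x = 0 := by
    rintro ⟨T, hT⟩
    obtain ⟨⟨t, ht⟩, hdim⟩ := hQ T hT
    have h := ExtInt.ofInt_lt_ofInt.1 (hdim.trans_lt hb)
    have hlt : Submodule.span ℝ {t} ⊔ vectorSpan ℝ (T : Set (Fin 3 → ℝ)) < ⊤ := by
      rw [lt_top_iff_ne_top]
      intro htop
      have h1 := Submodule.finrank_add_le_finrank_add_finrank (Submodule.span ℝ {t})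
        (vectorSpan ℝ (T : Set (Fin 3 → ℝ)))
      have h2 := finrank_span_le_card (R := ℝ) ({t} : Set (Fin 3 → ℝ))
      rw [htop, finrank_top] at h1
      unfold cellDim at h
      simp only [Module.finrank_fintype_fun_eq_card, Fintype.card_fin, Set.toFinset_singleton,
        Finset.card_singleton] at h1 h2
      omega
    obtain ⟨f, hf, hle⟩ := Submodule.exists_le_ker_of_lt_top _ hlt
    refine ⟨f, hf, fun x hx => ?_⟩
    refine convexHull_min (fun y hy => ?_) (LinearMap.ker f).convex hx
    have h1 : t ∈ LinearMap.ker f :=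
      hle (Submodule.mem_sup_left (Submodule.mem_span_singleton_self t))
    have h2 : y - t ∈ LinearMap.ker f :=
      hle (Submodule.mem_sup_right (vsub_mem_vectorSpan ℝ hy ht))
    simpa using add_mem h2 h1
  choose f hf0 hf using key
  refine ⟨Set.range f, Set.finite_range f, ?_, fun x hx => ?_⟩
  · rintro _ ⟨T, rfl⟩
    exact hf0 T
  · obtain ⟨T, hT, hxT⟩ := hA x hx
    exact ⟨_, ⟨⟨T, hT⟩, rfl⟩, hf ⟨T, hT⟩ _ hxT⟩

/-- The zero set in the simplex lies on a line through x. Scale its direction w so that some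
coordinate j of w is 1: coordinates of the simplex lie in [0,1], so any other zero y = x + (y j - x
j)w lies between x - w and x + w. -/
lemma exists_cell_of_form {f : (Fin 3 → ℝ) →ₗ[ℝ] ℝ} (hf : f ≠ 0) :
    ∃ T : Finset (Fin 3 → ℝ), T.Nonempty ∧ cellDim T ≤ 1 ∧
      ∀ x : stdSimplex ℝ (Fin 3), f ⇑x = 0 → ⇑x ∈ convexHull ℝ (T : Set (Fin 3 → ℝ)) := by
  classical
  have hpair : ∀ y z : Fin 3 → ℝ, cellDim {y, z} ≤ 1 := by
    intro y z
    unfold cellDim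
    rw [Finset.coe_pair, vectorSpan_pair]
    have := finrank_span_le_card (R := ℝ) ({y -ᵥ z} : Set (Fin 3 → ℝ))
    simp only [Set.toFinset_singleton, Finset.card_singleton] at this
    exact_mod_cast this
  by_cases hne : ∃ x : stdSimplex ℝ (Fin 3), f ⇑x = 0
  swap
  -- A form such as the coordinate sum has no zero on the simplex; any cell will do.
  · exact ⟨{0, 0}, by simp, hpair _ _, fun x hx => absurd ⟨x, hx⟩ hne⟩
  obtain ⟨x, hx⟩ := hne
  let g : (Fin 3 → ℝ) →ₗ[ℝ] ℝ := ∑ i, LinearMap.proj i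
  have hg : ∀ y : stdSimplex ℝ (Fin 3), g ⇑y = 1 := by
    intro y
    simp [g]
  have hker : Module.finrank ℝ (LinearMap.ker f) = 2 := by
    have h1 := LinearMap.finrank_range_add_finrank_ker f
    rw [LinearMap.range_eq_top.2 (LinearMap.surjective hf), finrank_top] at h1
    simp only [Module.finrank_self, Module.finrank_fintype_fun_eq_card, Fintype.card_fin] at h1
    omega
  have hlt : Module.finrank ℝ ↥(LinearMap.ker f ⊓ LinearMap.ker g) ≤ 1 := by
    have : LinearMap.ker f ⊓ LinearMap.ker g < LinearMap.ker f := by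
      refine lt_of_le_of_ne inf_le_left fun h => ?_
      have hxk : ⇑x ∈ LinearMap.ker f := hx
      rw [← h] at hxk
      have : g ⇑x = 0 := hxk.2
      rw [hg] at this
      exact one_ne_zero this
    have := Submodule.finrank_lt_finrank_of_lt this
    omega
  obtain ⟨u, hu⟩ := finrank_le_one_iff.1 hlt
  have hu' : ∀ y : stdSimplex ℝ (Fin 3), f ⇑y = 0 → ∃ c : ℝ, ⇑y = ⇑x + c • (u : Fin 3 → ℝ) := by
    intro y hy
    obtain ⟨c, hc⟩ := hu ⟨⇑y - ⇑x, by
      constructor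
      · change f (⇑y - ⇑x) = 0
        rw [map_sub, hx, hy, sub_zero]
      · change g (⇑y - ⇑x) = 0
        rw [map_sub, hg, hg, sub_self]⟩
    refine ⟨c, ?_⟩
    have : c • (u : Fin 3 → ℝ) = ⇑y - ⇑x := congrArg Subtype.val hc
    rw [this, add_sub_cancel]
  by_cases hu0 : (u : Fin 3 → ℝ) = 0
  · refine ⟨{⇑x, ⇑x}, by simp, hpair _ _, fun y hy => ?_⟩
    obtain ⟨c, hc⟩ := hu' y hy
    rw [hc, hu0]
    simp
  obtain ⟨j, hj⟩ : ∃ j, (u : Fin 3 → ℝ) j ≠ 0 := by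
    by_contra! h
    exact hu0 (funext h)
  set w : Fin 3 → ℝ := ((u : Fin 3 → ℝ) j)⁻¹ • (u : Fin 3 → ℝ) with hw
  refine ⟨{⇑x - w, ⇑x + w}, by simp, hpair _ _, fun y hy => ?_⟩
  obtain ⟨c, hc⟩ := hu' y hy
  have hyj : y j = x j + c * (u : Fin 3 → ℝ) j := by
    rw [hc]
    simp
  have b1 := stdSimplex.zero_le x j
  have b2 := stdSimplex.le_one x j
  have b3 := stdSimplex.zero_le y j
  have b4 := stdSimplex.le_one y j
  rw [Finset.coe_pair, convexHull_pair, segment_eq_image]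
  refine ⟨(1 + (y j - x j)) / 2, ⟨by linarith, by linarith⟩, ?_⟩
  have hcw : c • (u : Fin 3 → ℝ) = (y j - x j) • w := by
    rw [hw, smul_smul, hyj]
    congr 1
    field_simp
    ring
  rw [hcw] at hc
  refine Eq.trans ?_ hc.symm
  funext i
  simp only [Pi.add_apply, Pi.smul_apply, Pi.sub_apply, smul_eq_mul]
  ring

lemma PolyDimLE.of_coveredByLines {A : Set (stdSimplex ℝ (Fin 3))} (h : CoveredByLines A)
    (hb : ExtInt.ofInt 1 ≤ b) : PolyDimLE A b := by
  classical
  obtain ⟨L, hL, h0, hA⟩ := h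
  choose! T hne hdim hT using fun f (hf : f ≠ 0) => exists_cell_of_form hf
  refine ⟨hL.toFinset.image T, fun T' hT' => ?_, fun x hx => ?_⟩
  · obtain ⟨f, hf, rfl⟩ := Finset.mem_image.1 hT'
    have hf0 := h0 f (hL.mem_toFinset.1 hf)
    exact ⟨hne f hf0, (ExtInt.ofInt_le_ofInt.2 (hdim f hf0)).trans hb⟩
  · obtain ⟨f, hf, hfx⟩ := hA x hx
    exact ⟨T f, Finset.mem_image_of_mem _ (hL.mem_toFinset.2 hf), hT f (h0 f hf) x hfx⟩

end PolyDim

/-! ### Allowability in terms of the union of the strata of small perversity -/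

section Allowable

variable {X : Type u} [TopologicalSpace X] {n : ℕ} {F : FilteredSpace X n}

/-- The union of the singular strata `S` with `j - codim S + p(S) < 0`. -/
def Perversity.badSet (p : Perversity F) (j : ℕ) : Set X :=
  {x | ∃ S : F.Stratum, S.IsSingular ∧ ExtInt.ofInt ((j : ℤ) - S.codim) + p.val S < 0 ∧
    x ∈ S.carrier}

lemma Perversity.antitone_badSet (p : Perversity F) : Antitone p.badSet := by
  rintro i j hij x ⟨S, hS, hlt, hx⟩
  refine ⟨S, hS, lt_of_le_of_lt ?_ hlt, hx⟩
  have : ExtInt.ofInt ((i : ℤ) - S.codim) ≤ ExtInt.ofInt ((j : ℤ) - S.codim) :=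
    ExtInt.ofInt_le_ofInt.2 (by omega)
  gcongr

/-- For an m-simplex, a stratum with dimension bound below k lies in B (m - k): the index j in B j
is the dimension of the simplex minus this threshold. -/
lemma Perversity.mem_badSet_of_lt {p : Perversity F} {S : F.Stratum} (hS : S.IsSingular)
    {m j : ℕ} {k : ℤ} (hm : (m : ℤ) = j + k)
    (h : ExtInt.ofInt ((m : ℤ) - S.codim) + p.val S < ExtInt.ofInt k) {x : X}
    (hx : x ∈ S.carrier) : x ∈ p.badSet j := by
  refine ⟨S, hS, ?_, hx⟩
  rwa [hm, show (j : ℤ) + k - S.codim = (j - S.codim) + k by ring, ExtInt.ofInt_add_lt_iff] at h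

lemma FilteredSpace.LocallyFiniteStratification.finite_setOf_mem_range
    (hF : F.LocallyFiniteStratification) {K : Type*} [TopologicalSpace K] [CompactSpace K]
    (σ : C(K, X)) : 
      Set.Finite {S | ∃ t, σ t ∈ Stratum.carrier (F := F) S} := by
  choose U hU hfin using hF
  obtain ⟨s, hs⟩ := CompactSpace.elim_nhds_subcover (fun t => σ ⁻¹' U (σ t))
    fun t => σ.continuous.continuousAt (hU (σ t))
  refine (s.finite_toSet.biUnion fun t _ => hfin (σ t)).subset ?_
  rintro S ⟨t, ht⟩
  have : t ∈ ⋃ x ∈ s, σ ⁻¹' U (σ x) := hs ▸ Set.mem_univ t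
  obtain ⟨x, hx, htx⟩ := Set.mem_iUnion₂.1 this
  exact Set.mem_biUnion hx ⟨σ t, ht, htx⟩

/-- Local finiteness enters here: it replaces a possibly infinite union of strata by finitely many
preimages of dimension below k, so that dimension bounds for single strata pass to B j. -/
lemma Perversity.AllowableMap.exists_finite (hF : F.LocallyFiniteStratification)
    {p : Perversity F} {m : ℕ} {σ : C(stdSimplex ℝ (Fin (m + 1)), X)} (h : p.AllowableMap σ)
    {j : ℕ} {k : ℤ} (hm : (m : ℤ) = j + k) : ∃ I : Set F.Stratum, I.Finite ∧
      (∀ S ∈ I, ∃ b, b < ExtInt.ofInt k ∧ PolyDimLE (σ ⁻¹' S.carrier) b) ∧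
      {t | σ t ∈ p.badSet j} ⊆ ⋃ S : I, σ ⁻¹' S.1.carrier := by
  refine ⟨{S | ∃ t, σ t ∈ S.carrier} ∩
    {S | S.IsSingular ∧ ExtInt.ofInt ((j : ℤ) - S.codim) + p.val S < 0},
    (hF.finite_setOf_mem_range σ).inter_of_left _, ?_, ?_⟩
  · rintro S ⟨-, hS, hlt⟩
    refine ⟨_, ?_, h S hS⟩
    rwa [hm, show (j : ℤ) + k - S.codim = (j - S.codim) + k by ring, ExtInt.ofInt_add_lt_iff]
  · rintro t ⟨S, hS, hlt, ht⟩
    exact Set.mem_iUnion.2 ⟨⟨S, ⟨t, ht⟩, hS, hlt⟩, ht⟩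

lemma Perversity.AllowableMap.notMem_badSet (hF : F.LocallyFiniteStratification)
    {p : Perversity F} {m : ℕ} {σ : C(stdSimplex ℝ (Fin (m + 1)), X)} (h : p.AllowableMap σ)
    (t : stdSimplex ℝ (Fin (m + 1))) : σ t ∉ p.badSet m := by
  obtain ⟨I, hI, hdim, hsub⟩ := h.exists_finite hF (j := m) (k := 0) (by simp)
  intro ht
  obtain ⟨⟨S, hS⟩, htS⟩ := Set.mem_iUnion.1 (hsub ht)
  obtain ⟨b, hb, hP⟩ := hdim S hS
  have htS' : t ∈ σ ⁻¹' S.carrier := htS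
  rw [hP.eq_empty hb] at htS'
  exact htS'

lemma Perversity.AllowableMap.finite_badSet (hF : F.LocallyFiniteStratification)
    {p : Perversity F} {m : ℕ} {σ : C(stdSimplex ℝ (Fin (m + 2)), X)} (h : p.AllowableMap σ) :
    {t | σ t ∈ p.badSet m}.Finite := by
  obtain ⟨I, hI, hdim, hsub⟩ := h.exists_finite hF (j := m) (k := 1) (by simp)
  have := hI.to_subtype
  refine (Set.finite_iUnion fun S => ?_).subset hsub
  obtain ⟨b, hb, hP⟩ := hdim S.1 S.2
  exact hP.finite hb

lemma Perversity.allowableMap_zero_iff (hF : F.LocallyFiniteStratification) (p : Perversity F)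
    (σ : C(stdSimplex ℝ (Fin 1), X)) : p.AllowableMap σ ↔ σ (vtx 0) ∉ p.badSet 0 := by
  refine ⟨fun h => h.notMem_badSet hF _, fun h S hS => ?_⟩
  rcases lt_or_ge (ExtInt.ofInt (((0 : ℕ) : ℤ) - S.codim) + p.val S) (ExtInt.ofInt 0) with hb | hb
  · have : σ ⁻¹' S.carrier = ∅ := Set.eq_empty_of_forall_notMem fun t ht => h (by
      rw [Subsingleton.elim (vtx 0) t]
      exact mem_badSet_of_lt hS (by simp) hb ht)
    rw [this]
    exact PolyDimLE.empty
  · exact PolyDimLE.of_le _ hb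

lemma Perversity.allowableMap_one_iff (hF : F.LocallyFiniteStratification) (p : Perversity F)
    (σ : C(stdSimplex ℝ (Fin 2), X)) : p.AllowableMap σ ↔ IsAllowablePath p.badSet σ := by
  refine ⟨fun h => ⟨h.finite_badSet hF, h.notMem_badSet hF⟩, fun h S hS => ?_⟩
  rcases lt_or_ge (ExtInt.ofInt (((1 : ℕ) : ℤ) - S.codim) + p.val S) (ExtInt.ofInt 0) with hb | hb
  · have : σ ⁻¹' S.carrier = ∅ := Set.eq_empty_of_forall_notMem fun t ht =>
      h.notMem t (mem_badSet_of_lt hS (by simp) hb ht)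
    rw [this]
    exact PolyDimLE.empty
  rcases lt_or_ge (ExtInt.ofInt (((1 : ℕ) : ℤ) - S.codim) + p.val S) (ExtInt.ofInt 1)
    with hb' | hb'
  · exact PolyDimLE.of_finite (h.finite.subset fun t ht => mem_badSet_of_lt hS (by simp) hb' ht) hb
  · exact PolyDimLE.of_le _ hb'

/-- For the converse, a stratum with bound below 0, 1 or 2 lies in B 2, B 1 or B 0 respectively, and
a bound of at least 2 is no condition. -/
lemma Perversity.allowableMap_two_iff (hF : F.LocallyFiniteStratification) (p : Perversity F)
    (σ : C(stdSimplex ℝ (Fin 3), X)) : p.AllowableMap σ ↔ IsAllowableTriangle p.badSet σ := by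
  refine ⟨fun h => ⟨?_, h.finite_badSet hF, h.notMem_badSet hF⟩, fun h S hS => ?_⟩
  · obtain ⟨I, hI, hdim, hsub⟩ := h.exists_finite hF (j := 0) (k := 2) (by simp)
    have := hI.to_subtype
    refine (CoveredByLines.iUnion fun S => ?_).mono hsub
    obtain ⟨b, hb, hP⟩ := hdim S.1 S.2
    exact hP.coveredByLines hb
  rcases lt_or_ge (ExtInt.ofInt (((2 : ℕ) : ℤ) - S.codim) + p.val S) (ExtInt.ofInt 0) with hb | hb
  · have : σ ⁻¹' S.carrier = ∅ := Set.eq_empty_of_forall_notMem fun t ht =>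
      h.notMem t (mem_badSet_of_lt hS (by simp) hb ht)
    rw [this]
    exact PolyDimLE.empty
  rcases lt_or_ge (ExtInt.ofInt (((2 : ℕ) : ℤ) - S.codim) + p.val S) (ExtInt.ofInt 1)
    with hb' | hb'
  · exact PolyDimLE.of_finite (h.finite.subset fun t ht => mem_badSet_of_lt hS (by simp) hb' ht) hb
  rcases lt_or_ge (ExtInt.ofInt (((2 : ℕ) : ℤ) - S.codim) + p.val S) (ExtInt.ofInt 2)
    with hb'' | hb''
  · exact PolyDimLE.of_coveredByLines
      (h.lines.mono fun t ht => mem_badSet_of_lt hS (by simp) hb'' ht) hb'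
  · exact PolyDimLE.of_le _ hb''

end Allowable

/-! ### Elements of the homology of complexes of abelian groups -/

section Homology

variable (C : ChainComplex AddCommGrpCat.{u} ℕ) (i : ℕ)

lemma exists_iCycles_eq {z : C.X i} (hz : ∀ j, C.d i j z = 0) : ∃ c, C.iCycles i c = z := by
  have h := ShortComplex.exact_of_f_is_kernel (ShortComplex.mk (C.iCycles i)
    (C.d i ((ComplexShape.down ℕ).next i)) (by simp)) (C.cyclesIsKernel i _ rfl)
  exact (ShortComplex.ab_exact_iff _).1 h z (hz _)

lemma d_iCycles_apply (j : ℕ) (c : C.cycles i) : C.d i j (C.iCycles i c) = 0 := by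
  rw [← ConcreteCategory.comp_apply, C.iCycles_d]
  rfl

lemma iCycles_injective : Function.Injective (C.iCycles i) :=
  (AddCommGrpCat.mono_iff_injective _).1 inferInstance

lemma homologyπ_surjective : Function.Surjective (C.homologyπ i) :=
  (AddCommGrpCat.epi_iff_surjective _).1 inferInstance

lemma homologyπ_eq_zero_iff (c : C.cycles i) :
    C.homologyπ i c = 0 ↔ ∃ w, C.d (i + 1) i w = C.iCycles i c := by
  constructor
  · intro h
    have hex := ShortComplex.exact_of_g_is_cokernel (ShortComplex.mk (C.toCycles (i + 1) i)
      (C.homologyπ i) (by simp)) (C.homologyIsCokernel _ i (ChainComplex.prev ℕ i))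
    obtain ⟨w, hw⟩ := (ShortComplex.ab_exact_iff _).1 hex c h
    refine ⟨w, ?_⟩
    have h1 := congrArg (C.iCycles i) hw
    rw [← h1]
    change _ = C.iCycles i (C.toCycles (i + 1) i w)
    rw [← ConcreteCategory.comp_apply, C.toCycles_i]
  · rintro ⟨w, hw⟩
    have h1 : c = C.toCycles (i + 1) i w := by
      apply iCycles_injective
      rw [← hw, ← ConcreteCategory.comp_apply, C.toCycles_i]
    rw [h1, ← ConcreteCategory.comp_apply, C.toCycles_comp_homologyπ]
    rfl

variable {C} {D : ChainComplex AddCommGrpCat.{u} ℕ} (f : C ⟶ D)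

lemma isIso_homologyMap_of_elements
    (hinj : ∀ (z : C.X i) (w : D.X (i + 1)), f.f i z = D.d (i + 1) i w →
      ∃ w', C.d (i + 1) i w' = z)
    (hsurj : ∀ z : D.X i, (∀ j, D.d i j z = 0) →
      ∃ (z' : C.X i) (w : D.X (i + 1)), (∀ j, C.d i j z' = 0) ∧ z = f.f i z' + D.d (i + 1) i w) :
    IsIso (HomologicalComplex.homologyMap f i) := by
  have hcyc : ∀ c, D.iCycles i (HomologicalComplex.cyclesMap f i c) = f.f i (C.iCycles i c) := by
    intro c
    rw [← ConcreteCategory.comp_apply, HomologicalComplex.cyclesMap_i,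
      ConcreteCategory.comp_apply]
  have hπ : ∀ c, HomologicalComplex.homologyMap f i (C.homologyπ i c) =
      D.homologyπ i (HomologicalComplex.cyclesMap f i c) := by
    intro c
    rw [← ConcreteCategory.comp_apply, HomologicalComplex.homologyπ_naturality,
      ConcreteCategory.comp_apply]
  rw [ConcreteCategory.isIso_iff_bijective]
  constructor
  · refine (injective_iff_map_eq_zero (HomologicalComplex.homologyMap f i).hom).2 fun x hx => ?_
    obtain ⟨c, rfl⟩ := homologyπ_surjective C i x
    have hx' : HomologicalComplex.homologyMap f i (C.homologyπ i c) = 0 := hx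
    rw [hπ, homologyπ_eq_zero_iff] at hx'
    obtain ⟨w, hw⟩ := hx'
    rw [homologyπ_eq_zero_iff]
    exact hinj _ w (by rw [hw, hcyc])
  · intro y
    obtain ⟨c, rfl⟩ := homologyπ_surjective D i y
    obtain ⟨z', w, hz', h⟩ := hsurj (D.iCycles i c) fun j => d_iCycles_apply D i j c
    obtain ⟨c', rfl⟩ := exists_iCycles_eq C i hz'
    refine ⟨C.homologyπ i c', ?_⟩
    rw [hπ, ← sub_eq_zero, ← map_sub, homologyπ_eq_zero_iff]
    refine ⟨-w, ?_⟩
    rw [map_sub, hcyc, h, map_neg]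
    abel

end Homology

/-! ### Chains of simplicial sets -/

lemma AddCommGrpCat.sum_apply {M N : AddCommGrpCat.{u}} {ι : Type*} (s : Finset ι)
    (f : ι → (M ⟶ N)) (x : M) : (∑ i ∈ s, f i) x = ∑ i ∈ s, f i x := by
  change AddCommGrpCat.homAddEquiv (∑ i ∈ s, f i) x = _
  rw [map_sum, AddMonoidHom.finsetSum_apply]
  rfl

section Chains

variable {K : SSet.{u}}

/-- The chain of a simplex with coefficient `1`. -/
noncomputable def chainOf {m : ℕ} (σ : K.obj (op ⦋m⦌)) : (chains.obj K).X m :=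
  (Finsupp.single σ 1 : K.obj (op ⦋m⦌) →₀ ℤ)

lemma d_chainOf {m : ℕ} (σ : K.obj (op ⦋m + 1⦌)) : (chains.obj K).d (m + 1) m (chainOf σ) =
    ∑ i : Fin (m + 2), (-1 : ℤ) ^ (i : ℕ) • chainOf (K.δ i σ) := by
  have h : (chains.obj K).d (m + 1) m = ∑ i : Fin (m + 2), (-1 : ℤ) ^ (i : ℕ) •
      SimplicialObject.δ (((SimplicialObject.whiskering _ _).obj freeAb).obj K) i :=
    AlgebraicTopology.AlternatingFaceMapComplex.obj_d_eq _ m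
  rw [h]
  refine (AddCommGrpCat.sum_apply _ _ _).trans (Finset.sum_congr rfl fun i _ => ?_)
  have e : SimplicialObject.δ (((SimplicialObject.whiskering _ _).obj freeAb).obj K) i (chainOf σ) =
      chainOf (K.δ i σ) := Finsupp.mapDomain_single
  exact congrArg (fun x : (chains.obj K).X m => (-1 : ℤ) ^ (i : ℕ) • x) e

lemma map_chainOf {L : SSet.{u}} (f : K ⟶ L) {m : ℕ} (σ : K.obj (op ⦋m⦌)) :
    (chains.map f).f m (chainOf σ) = chainOf (f.app _ σ) :=
  Finsupp.mapDomain_single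

lemma chains_induction {m : ℕ} {P : (chains.obj K).X m → Prop} (ξ : (chains.obj K).X m)
    (zero : P 0) (add : ∀ a b, P a → P b → P (a + b)) (neg : ∀ a, P a → P (-a))
    (single : ∀ σ, P (chainOf σ)) : P ξ := by
  have key : ∀ ζ : K.obj (op ⦋m⦌) →₀ ℤ, P ζ := by
    intro ζ
    induction ζ using Finsupp.induction_linear with
    | zero => exact zero
    | add a b ha hb => exact add a b ha hb
    | single σ c =>
      have h : (Finsupp.single σ c : K.obj (op ⦋m⦌) →₀ ℤ) = c • Finsupp.single σ (1 : ℤ) := by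
        simp
      rw [h]
      induction c with
      | zero => rw [zero_smul]; exact zero
      | succ c ih => rw [add_smul, one_smul]; exact add _ _ (ih (by simp)) (single σ)
      | pred c ih =>
        rw [sub_smul, one_smul, sub_eq_add_neg]
        exact add _ _ (ih (by simp)) (neg _ (single σ))
  exact key ξ

/-- The homomorphism on chains with given values on simplices. -/
noncomputable def chainsLift {m : ℕ} {A : Type u} [AddCommGroup A] (φ : K.obj (op ⦋m⦌) → A) :
    (chains.obj K).X m →+ A :=
  Finsupp.liftAddHom (α := K.obj (op ⦋m⦌)) (M := ℤ) fun σ => zmultiplesHom A (φ σ)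

lemma chainsLift_chainOf {m : ℕ} {A : Type u} [AddCommGroup A] (φ : K.obj (op ⦋m⦌) → A)
    (σ : K.obj (op ⦋m⦌)) : chainsLift φ (chainOf σ) = φ σ := by
  refine (Finsupp.liftAddHom_apply_single _ _ _).trans ?_
  simp

end Chains

/-! ### Full simplices in dimension at most two -/

section FullSimplices

variable {X : Type u} [TopologicalSpace X] {n : ℕ} {F : FilteredSpace X n}

/-- The singular simplex given by a continuous map. -/
noncomputable def singularSimplex {m : ℕ} (σ : C(stdSimplex ℝ (Fin (m + 1)), X)) :
    (TopCat.toSSet.obj (TopCat.of X)).obj (op ⦋m⦌) :=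
  (TopCat.toSSetObjEquiv (TopCat.of X) (op ⦋m⦌)).symm σ

lemma exists_singularSimplex_eq {m : ℕ} (σ : (TopCat.toSSet.obj (TopCat.of X)).obj (op ⦋m⦌)) :
    ∃ f, singularSimplex f = σ :=
  ⟨_, (TopCat.toSSetObjEquiv (TopCat.of X) (op ⦋m⦌)).symm_apply_apply σ⟩

lemma δ_singularSimplex {m : ℕ} (σ : C(stdSimplex ℝ (Fin (m + 2)), X)) (i : Fin (m + 2)) :
    (TopCat.toSSet.obj (TopCat.of X)).δ i (singularSimplex σ) =
      singularSimplex (σ.comp (affineSimplex fun j => vtx (i.succAbove j))) := by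
  have h : affineSimplex (fun j => vtx (i.succAbove j)) =
      ⟨stdSimplex.map i.succAbove, stdSimplex.continuous_map _⟩ := by
    ext t : 1
    exact (map_eq_affineSimplex _ _).symm
  rw [h]
  rfl

lemma allowable_singularSimplex (p : Perversity F) {m : ℕ}
    (σ : C(stdSimplex ℝ (Fin (m + 1)), X)) :
    p.Allowable (singularSimplex σ) ↔ p.AllowableMap σ := by
  unfold Perversity.Allowable singularSimplex
  rw [Equiv.apply_symm_apply]

lemma Perversity.Full.allowable {p : Perversity F} {m : ℕ}
    {σ : (TopCat.toSSet.obj (TopCat.of X)).obj (op ⦋m⦌)} (h : p.Full σ) : p.Allowable σ := by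
  have := h _ (𝟙 _) fun _ _ h => h
  rwa [op_id, Functor.map_id_apply] at this

lemma Perversity.full_zero_iff (p : Perversity F)
    (σ : (TopCat.toSSet.obj (TopCat.of X)).obj (op ⦋0⦌)) : p.Full σ ↔ p.Allowable σ := by
  refine ⟨fun h => h.allowable, fun h e θ hθ => ?_⟩
  have : Mono θ := SimplexCategory.mono_iff_injective.2 hθ
  induction e using SimplexCategory.rec with
  | _ m =>
  have hm : m ≤ 0 := SimplexCategory.len_le_of_mono θ
  obtain rfl : m = 0 := by omega
  change ⦋0⦌ ⟶ ⦋0⦌ at θ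
  obtain rfl : θ = 𝟙 _ := SimplexCategory.eq_id_of_mono θ
  change p.Allowable ((TopCat.toSSet.obj (TopCat.of X)).map (𝟙 (op ⦋0⦌)) σ)
  rwa [Functor.map_id_apply]

/-- An injective map to [m + 1] is the identity or factors through a coface, so fullness can be
checked by induction on the faces. -/
lemma Perversity.full_succ_iff (p : Perversity F) {m : ℕ}
    (σ : (TopCat.toSSet.obj (TopCat.of X)).obj (op ⦋m + 1⦌)) :
    p.Full σ ↔ p.Allowable σ ∧ ∀ i, p.Full ((TopCat.toSSet.obj (TopCat.of X)).δ i σ) := by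
  refine ⟨fun h => ⟨h.allowable, fun i e θ hθ => ?_⟩, fun h e θ hθ => ?_⟩
  · have := h e (θ ≫ SimplexCategory.δ i) (by
      intro a b hab
      exact hθ (Fin.succAbove_right_injective hab))
    rwa [op_comp, Functor.map_comp_apply] at this
  · induction e using SimplexCategory.rec with
    | _ k =>
    change ⦋k⦌ ⟶ ⦋m + 1⦌ at θ
    by_cases hs : Function.Surjective θ.toOrderHom
    · have hk : k = m + 1 := by
        have := Fintype.card_of_bijective ⟨hθ, hs⟩
        simpa using this
      subst hk
      have : Mono θ := SimplexCategory.mono_iff_injective.2 hθ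
      obtain rfl : θ = 𝟙 _ := SimplexCategory.eq_id_of_mono θ
      rw [op_id, Functor.map_id_apply]
      exact h.1
    · obtain ⟨i, θ', rfl⟩ := SimplexCategory.eq_comp_δ_of_not_surjective θ hs
      have := h.2 i _ θ' (by
        intro a b hab
        exact hθ (congrArg (SimplexCategory.δ i).toOrderHom hab))
      rw [op_comp, Functor.map_comp_apply]
      exact this

/-- The singular `0`-simplex at a point. -/
noncomputable def singularPoint (x : X) : (TopCat.toSSet.obj (TopCat.of X)).obj (op ⦋0⦌) :=
  singularSimplex (ContinuousMap.const _ x)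

lemma singularSimplex_zero (σ : C(stdSimplex ℝ (Fin 1), X)) :
    singularSimplex σ = singularPoint (σ (vtx 0)) := by
  refine congrArg singularSimplex ?_
  ext t : 1
  rw [Subsingleton.elim t (vtx 0)]
  rfl

lemma δ_zero_path (γ : C(stdSimplex ℝ (Fin 2), X)) :
    (TopCat.toSSet.obj (TopCat.of X)).δ 0 (singularSimplex γ) = singularPoint (γ (vtx 1)) := by
  rw [δ_singularSimplex, singularSimplex_zero, ContinuousMap.comp_apply, affineSimplex_vertex]
  rfl

lemma δ_one_path (γ : C(stdSimplex ℝ (Fin 2), X)) :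
    (TopCat.toSSet.obj (TopCat.of X)).δ 1 (singularSimplex γ) = singularPoint (γ (vtx 0)) := by
  rw [δ_singularSimplex, singularSimplex_zero, ContinuousMap.comp_apply, affineSimplex_vertex]
  rfl

lemma δ_zero_triangle (τ : C(stdSimplex ℝ (Fin 3), X)) :
    (TopCat.toSSet.obj (TopCat.of X)).δ 0 (singularSimplex τ) =
      singularSimplex (τ.comp (seg (vtx 1) (vtx 2))) := by
  rw [δ_singularSimplex]
  congr 3
  funext i
  fin_cases i <;> rfl

lemma δ_one_triangle (τ : C(stdSimplex ℝ (Fin 3), X)) :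
    (TopCat.toSSet.obj (TopCat.of X)).δ 1 (singularSimplex τ) =
      singularSimplex (τ.comp (seg (vtx 0) (vtx 2))) := by
  rw [δ_singularSimplex]
  congr 3
  funext i
  fin_cases i <;> rfl

lemma δ_two_triangle (τ : C(stdSimplex ℝ (Fin 3), X)) :
    (TopCat.toSSet.obj (TopCat.of X)).δ 2 (singularSimplex τ) =
      singularSimplex (τ.comp (seg (vtx 0) (vtx 1))) := by
  rw [δ_singularSimplex]
  congr 3
  funext i
  fin_cases i <;> rfl

lemma d_chainOf_path (γ : C(stdSimplex ℝ (Fin 2), X)) :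
    (singularChains X).d 1 0 (chainOf (singularSimplex γ)) =
      chainOf (singularPoint (γ (vtx 1))) - chainOf (singularPoint (γ (vtx 0))) := by
  refine (d_chainOf (singularSimplex γ)).trans ?_
  rw [Fin.sum_univ_two, δ_zero_path, δ_one_path]
  simp [sub_eq_add_neg]

lemma d_chainOf_triangle (τ : C(stdSimplex ℝ (Fin 3), X)) :
    (singularChains X).d 2 1 (chainOf (singularSimplex τ)) =
      chainOf (singularSimplex (τ.comp (seg (vtx 1) (vtx 2)))) -
        chainOf (singularSimplex (τ.comp (seg (vtx 0) (vtx 2)))) +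
        chainOf (singularSimplex (τ.comp (seg (vtx 0) (vtx 1)))) := by
  refine (d_chainOf (singularSimplex τ)).trans ?_
  rw [Fin.sum_univ_three, δ_zero_triangle, δ_one_triangle, δ_two_triangle]
  simp [sub_eq_add_neg]

lemma full_singularPoint_iff (hF : F.LocallyFiniteStratification) (p : Perversity F)
    (x : X) : p.Full (singularPoint x) ↔ x ∉ p.badSet 0 := by
  rw [p.full_zero_iff, singularPoint, allowable_singularSimplex, p.allowableMap_zero_iff hF]
  rfl

lemma allowable_path_iff (hF : F.LocallyFiniteStratification) (p : Perversity F)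
    (γ : C(stdSimplex ℝ (Fin 2), X)) :
    p.Allowable (singularSimplex γ) ↔ IsAllowablePath p.badSet γ := by
  rw [allowable_singularSimplex, p.allowableMap_one_iff hF]

lemma allowable_triangle_iff (hF : F.LocallyFiniteStratification) (p : Perversity F)
    (τ : C(stdSimplex ℝ (Fin 3), X)) :
    p.Allowable (singularSimplex τ) ↔ IsAllowableTriangle p.badSet τ := by
  rw [allowable_singularSimplex, p.allowableMap_two_iff hF]

lemma full_path_iff (hF : F.LocallyFiniteStratification) (p : Perversity F)
    (γ : C(stdSimplex ℝ (Fin 2), X)) :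
    p.Full (singularSimplex γ) ↔ IsFullPath p.badSet γ := by
  rw [p.full_succ_iff, allowable_path_iff hF, Fin.forall_fin_two, δ_zero_path, δ_one_path,
    full_singularPoint_iff hF, full_singularPoint_iff hF]
  exact ⟨fun h => ⟨h.1, h.2.2, h.2.1⟩, fun h => ⟨h.toIsAllowablePath, h.one, h.zero⟩⟩

lemma full_triangle_iff (hF : F.LocallyFiniteStratification) (p : Perversity F)
    (τ : C(stdSimplex ℝ (Fin 3), X)) :
    p.Full (singularSimplex τ) ↔ IsFullTriangle p.badSet τ := by
  rw [p.full_succ_iff, allowable_triangle_iff hF, Fin.forall_fin_succ, Fin.forall_fin_two]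
  change _ ∧ p.Full ((TopCat.toSSet.obj (TopCat.of X)).δ 0 _) ∧
    p.Full ((TopCat.toSSet.obj (TopCat.of X)).δ 1 _) ∧
    p.Full ((TopCat.toSSet.obj (TopCat.of X)).δ 2 _) ↔ _
  rw [δ_zero_triangle, δ_one_triangle, δ_two_triangle, full_path_iff hF, full_path_iff hF,
    full_path_iff hF]
  exact ⟨fun h => ⟨h.1, h.2.2.2, h.2.2.1, h.2.1⟩,
    fun h => ⟨h.toIsAllowableTriangle, h.edge12, h.edge02, h.edge01⟩⟩

end FullSimplices

/-! ### Comparison of the homologies in degrees zero and one -/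

section Comparison

variable {X : Type u} [TopologicalSpace X] {n : ℕ} {F : FilteredSpace X n}

lemma allowableChains_induction {p : Perversity F} {m : ℕ} {P : (singularChains X).X m → Prop}
    {ξ : (singularChains X).X m} (hξ : ξ ∈ allowableChains p m) (zero : P 0)
    (add : ∀ a b, P a → P b → P (a + b)) (neg : ∀ a, P a → P (-a))
    (single : ∀ σ, p.AllowableMap σ → P (chainOf (singularSimplex σ))) : P ξ := by
  refine AddSubgroup.closure_induction (p := fun ξ _ => P ξ) ?_ zero (fun a b _ _ => add a b)
    (fun a _ => neg a) hξ
  rintro _ ⟨σ, hσ, rfl⟩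
  obtain ⟨σ, rfl⟩ := exists_singularSimplex_eq σ
  exact single σ ((allowable_singularSimplex p σ).1 hσ)

lemma chainOf_mem_allowableChains {p : Perversity F} {m : ℕ}
    {σ : (TopCat.toSSet.obj (TopCat.of X)).obj (op ⦋m⦌)} (h : p.Allowable σ) :
    chainOf σ ∈ allowableChains p m :=
  AddSubgroup.subset_closure ⟨σ, h, rfl⟩

/-- A full simplex as a chain of the Gajer space. -/
noncomputable def gajerChainOf {p : Perversity F} {m : ℕ}
    (σ : (TopCat.toSSet.obj (TopCat.of X)).obj (op ⦋m⦌)) (h : p.Full σ) : (gajerChains p).X m :=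
  chainOf (K := (gajerSpace p).toSSet) (⟨σ, h⟩ : (gajerSpace p).obj (op ⦋m⦌))

lemma gajerToSingular_gajerChainOf {p : Perversity F} {m : ℕ}
    (σ : (TopCat.toSSet.obj (TopCat.of X)).obj (op ⦋m⦌)) (h : p.Full σ) :
    (gajerToSingular p).f m (gajerChainOf σ h) = chainOf σ :=
  map_chainOf _ _

lemma gajerChains_induction {p : Perversity F} {m : ℕ} {P : (gajerChains p).X m → Prop}
    (ξ : (gajerChains p).X m) (zero : P 0) (add : ∀ a b, P a → P b → P (a + b))
    (neg : ∀ a, P a → P (-a)) (single : ∀ σ h, P (gajerChainOf (singularSimplex σ) h)) : P ξ := by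
  refine chains_induction ξ zero add neg fun ⟨σ, h⟩ => ?_
  obtain ⟨σ, rfl⟩ := exists_singularSimplex_eq σ
  exact single σ h

lemma gajerToSingular_injective (p : Perversity F) (m : ℕ) :
    Function.Injective ((gajerToSingular p).f m) :=
  Finsupp.mapDomain_injective (f := (gajerSpace p).ι.app (op ⦋m⦌)) Subtype.val_injective

lemma d_gajerToSingular {p : Perversity F} (i j : ℕ) (ξ : (gajerChains p).X i) :
    (singularChains X).d i j ((gajerToSingular p).f i ξ) =
      (gajerToSingular p).f j ((gajerChains p).d i j ξ) := by
  rw [← ConcreteCategory.comp_apply, (gajerToSingular p).comm i j, ConcreteCategory.comp_apply]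

lemma d_gajerChainOf_path {p : Perversity F} {γ : C(stdSimplex ℝ (Fin 2), X)}
    (h : p.Full (singularSimplex γ)) (h1 : p.Full (singularPoint (γ (vtx 1))))
    (h0 : p.Full (singularPoint (γ (vtx 0)))) :
    (gajerChains p).d 1 0 (gajerChainOf _ h) = gajerChainOf _ h1 - gajerChainOf _ h0 := by
  apply gajerToSingular_injective
  rw [← d_gajerToSingular, map_sub, gajerToSingular_gajerChainOf, gajerToSingular_gajerChainOf,
    gajerToSingular_gajerChainOf, d_chainOf_path]

lemma d_gajerChainOf_triangle {p : Perversity F} {τ : C(stdSimplex ℝ (Fin 3), X)}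
    (h : p.Full (singularSimplex τ))
    (h12 : p.Full (singularSimplex (τ.comp (seg (vtx 1) (vtx 2)))))
    (h02 : p.Full (singularSimplex (τ.comp (seg (vtx 0) (vtx 2)))))
    (h01 : p.Full (singularSimplex (τ.comp (seg (vtx 0) (vtx 1))))) :
    (gajerChains p).d 2 1 (gajerChainOf _ h) =
      gajerChainOf _ h12 - gajerChainOf _ h02 + gajerChainOf _ h01 := by
  apply gajerToSingular_injective
  rw [← d_gajerToSingular, map_add, map_sub, gajerToSingular_gajerChainOf,
    gajerToSingular_gajerChainOf, gajerToSingular_gajerChainOf, gajerToSingular_gajerChainOf,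
    d_chainOf_triangle]

/-- The extended function gives a homomorphism `L` on singular 0-chains that kills boundaries of
allowable paths and is the projection modulo boundaries on full chains. Hence the class of z is
L(∂w) = 0. -/
lemma exists_d_eq_of_degree_zero (hF : F.LocallyFiniteStratification) (p : Perversity F)
    (z : (gajerChains p).X 0) {w : (singularChains X).X 1}
    (hw : w ∈ allowableChains p 1) (h : (gajerToSingular p).f 0 z = (singularChains X).d 1 0 w) :
    ∃ w', (gajerChains p).d 1 0 w' = z := by
  classical
  let R := ((gajerChains p).d 1 0).hom.range
  let φ : X → (gajerChains p).X 0 ⧸ R := fun x =>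
    if h : p.Full (singularPoint x) then QuotientAddGroup.mk' R (gajerChainOf _ h) else 0
  have hφ : ∀ γ, IsFullPath p.badSet γ → φ (γ (vtx 0)) = φ (γ (vtx 1)) := by
    intro γ hγ
    have h0 := (full_singularPoint_iff hF p _).2 hγ.zero
    have h1 := (full_singularPoint_iff hF p _).2 hγ.one
    simp only [φ, dif_pos h0, dif_pos h1]
    rw [eq_comm, ← sub_eq_zero, ← map_sub, ← d_gajerChainOf_path ((full_path_iff hF p γ).2 hγ)]
    exact (QuotientAddGroup.eq_zero_iff _).2 ⟨_, rfl⟩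
  obtain ⟨G, hG, hG'⟩ := exists_extension_of_forall_isFullPath φ hφ
  let L : (singularChains X).X 0 →+ (gajerChains p).X 0 ⧸ R := chainsLift fun σ =>
    G (TopCat.toSSetObjEquiv (TopCat.of X) (op ⦋0⦌) σ (vtx 0 : stdSimplex ℝ (Fin 1)))
  have hL : ∀ x, L (chainOf (singularPoint x)) = G x := fun x => chainsLift_chainOf _ _
  have hLz : L ((gajerToSingular p).f 0 z) = QuotientAddGroup.mk' R z := by
    refine gajerChains_induction (P := fun z => L ((gajerToSingular p).f 0 z) =
      QuotientAddGroup.mk' R z) z (by simp) (fun a b ha hb => by rw [map_add, map_add, map_add,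
        ha, hb]) (fun a ha => by rw [map_neg, map_neg, map_neg, ha]) fun σ hσ => ?_
    rw [gajerToSingular_gajerChainOf]
    generalize hx : σ (vtx 0) = x
    obtain rfl : σ = ContinuousMap.const _ x := by
      ext t : 1
      rw [Subsingleton.elim t (vtx 0), hx]
      rfl
    refine (hL x).trans ((hG x ((full_singularPoint_iff hF p x).1 hσ)).trans ?_)
    exact dif_pos hσ
  have hLd : L ((singularChains X).d 1 0 w) = 0 := by
    refine allowableChains_induction (P := fun w => L ((singularChains X).d 1 0 w) = 0) hw
      (by simp) (fun a b ha hb => by rw [map_add, map_add, ha, hb, add_zero])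
      (fun a ha => by rw [map_neg, map_neg, ha, neg_zero]) fun γ hγ => ?_
    rw [d_chainOf_path, map_sub, hL, hL, hG' γ ((p.allowableMap_one_iff hF γ).1 hγ), sub_self]
  rw [← h, hLz] at hLd
  exact (QuotientAddGroup.eq_zero_iff _).1 hLd

/-- As in degree zero, with the extended cocycle in place of the extended function. Each allowable
triangle of w is killed separately, even if its edges are not allowable and cancel only in ∂w. -/
lemma exists_d_eq_of_degree_one (hF : F.LocallyFiniteStratification) (p : Perversity F)
    (z : (gajerChains p).X 1) {w : (singularChains X).X 2}
    (hw : w ∈ allowableChains p 2) (h : (gajerToSingular p).f 1 z = (singularChains X).d 2 1 w) :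
    ∃ w', (gajerChains p).d 2 1 w' = z := by
  classical
  let R := ((gajerChains p).d 2 1).hom.range
  let φ : C(stdSimplex ℝ (Fin 2), X) → (gajerChains p).X 1 ⧸ R := fun γ =>
    if h : p.Full (singularSimplex γ) then QuotientAddGroup.mk' R (gajerChainOf _ h) else 0
  have hφ : IsFullCocycle p.badSet φ := by
    intro τ hτ
    have h12 := (full_path_iff hF p _).2 hτ.edge12
    have h02 := (full_path_iff hF p _).2 hτ.edge02
    have h01 := (full_path_iff hF p _).2 hτ.edge01
    simp only [φ, dif_pos h12, dif_pos h02, dif_pos h01]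
    rw [← map_sub, ← map_add, ← d_gajerChainOf_triangle ((full_triangle_iff hF p τ).2 hτ)]
    exact (QuotientAddGroup.eq_zero_iff _).2 ⟨_, rfl⟩
  obtain ⟨G, hG, hG'⟩ := hφ.exists_extension p.antitone_badSet
  let L : (singularChains X).X 1 →+ (gajerChains p).X 1 ⧸ R := chainsLift fun σ =>
    G (TopCat.toSSetObjEquiv (TopCat.of X) (op ⦋1⦌) σ)
  have hL : ∀ γ, L (chainOf (singularSimplex γ)) = G γ := fun γ => chainsLift_chainOf _ _
  have hLz : L ((gajerToSingular p).f 1 z) = QuotientAddGroup.mk' R z := by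
    refine gajerChains_induction (P := fun z => L ((gajerToSingular p).f 1 z) =
      QuotientAddGroup.mk' R z) z (by simp) (fun a b ha hb => by rw [map_add, map_add, map_add,
        ha, hb]) (fun a ha => by rw [map_neg, map_neg, map_neg, ha]) fun γ hγ => ?_
    rw [gajerToSingular_gajerChainOf]
    refine (hL γ).trans ((hG γ ((full_path_iff hF p γ).1 hγ)).trans ?_)
    exact dif_pos hγ
  have hLd : L ((singularChains X).d 2 1 w) = 0 := by
    refine allowableChains_induction (P := fun w => L ((singularChains X).d 2 1 w) = 0) hw
      (by simp) (fun a b ha hb => by rw [map_add, map_add, ha, hb, add_zero])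
      (fun a ha => by rw [map_neg, map_neg, ha, neg_zero]) fun τ hτ => ?_
    rw [d_chainOf_triangle, map_add, map_sub, hL, hL, hL,
      hG' τ ((p.allowableMap_two_iff hF τ).1 hτ)]
  rw [← h, hLz] at hLd
  exact (QuotientAddGroup.eq_zero_iff _).1 hLd

/-! ### Surjectivity in degrees zero and one. -/

lemma exists_gajerToSingular_eq (p : Perversity F)
    {ξ : (singularChains X).X 0} (hξ : ξ ∈ allowableChains p 0) :
    ∃ z, (gajerToSingular p).f 0 z = ξ := by
  refine allowableChains_induction (P := fun ξ => ∃ z, (gajerToSingular p).f 0 z = ξ) hξ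
    ⟨0, map_zero _⟩ ?_ ?_ fun σ hσ => ?_
  · rintro _ _ ⟨a, rfl⟩ ⟨b, rfl⟩
    exact ⟨a + b, map_add _ _ _⟩
  · rintro _ ⟨a, rfl⟩
    exact ⟨-a, map_neg _ _⟩
  · have h : p.Full (singularSimplex σ) :=
      (p.full_zero_iff _).2 ((allowable_singularSimplex p σ).2 hσ)
    exact ⟨gajerChainOf _ h, gajerToSingular_gajerChainOf _ h⟩

lemma chainOf_triangle_mem (hF : F.LocallyFiniteStratification) (p : Perversity F)
    {τ : C(stdSimplex ℝ (Fin 3), X)} (hτ : IsAllowableTriangle p.badSet τ)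
    (h12 : IsAllowablePath p.badSet (τ.comp (seg (vtx 1) (vtx 2))))
    (h02 : IsAllowablePath p.badSet (τ.comp (seg (vtx 0) (vtx 2))))
    (h01 : IsAllowablePath p.badSet (τ.comp (seg (vtx 0) (vtx 1)))) :
    chainOf (singularSimplex τ) ∈ intersectionChains p 2 := by
  refine ⟨chainOf_mem_allowableChains ((allowable_triangle_iff hF p τ).2 hτ), fun k => ?_⟩
  by_cases hk : k = 1
  · subst hk
    rw [d_chainOf_triangle]
    exact add_mem (sub_mem
      (chainOf_mem_allowableChains ((allowable_path_iff hF p _).2 h12))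
      (chainOf_mem_allowableChains ((allowable_path_iff hF p _).2 h02)))
      (chainOf_mem_allowableChains ((allowable_path_iff hF p _).2 h01))
  · rw [(singularChains X).shape 2 k (by
      change ¬ k + 1 = 2
      omega)]
    exact zero_mem _

/-- Up to boundaries, an allowable path is a full chain plus a chain that depends only on its end
points. -/
lemma exists_allowable_decomposition (hF : F.LocallyFiniteStratification) (p : Perversity F) :
    ∃ κ : (singularChains X).X 0 →+ (singularChains X).X 1,
    ∀ ξ ∈ allowableChains p 1, ∃ (r : (gajerChains p).X 1) (w : (singularChains X).X 2),
      w ∈ intersectionChains p 2 ∧ ξ = (gajerToSingular p).f 1 r +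
        κ ((singularChains X).d 1 0 ξ) + (singularChains X).d 2 1 w := by
  classical
  let P : X → C(stdSimplex ℝ (Fin 2), X) → Prop := fun x β =>
    IsAllowablePath p.badSet β ∧ β (vtx 0) ∉ p.badSet 0 ∧ β (vtx 1) = x ∧ x ∈ p.badSet 0
  -- One probe is fixed for each bad point that has any; good points get 0, since a probe that ends
  -- there is already full.
  obtain ⟨k, hk⟩ : ∃ k : X → (singularChains X).X 1, ∀ x, k x =
      if h : ∃ β, P x β then chainOf (singularSimplex h.choose) else 0 := ⟨_, fun _ => rfl⟩
  let κ : (singularChains X).X 0 →+ (singularChains X).X 1 := chainsLift fun σ =>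
    k (TopCat.toSSetObjEquiv (TopCat.of X) (op ⦋0⦌) σ (vtx 0 : stdSimplex ℝ (Fin 1)))
  have hκ : ∀ x, κ (chainOf (singularPoint x)) = k x := fun x => chainsLift_chainOf _ _
  have hprobe : ∀ β, IsAllowablePath p.badSet β → β (vtx 0) ∉ p.badSet 0 →
      ∃ (r : (gajerChains p).X 1) (w : (singularChains X).X 2), w ∈ intersectionChains p 2 ∧
        chainOf (singularSimplex β) =
          (gajerToSingular p).f 1 r + k (β (vtx 1)) + (singularChains X).d 2 1 w := by
    intro β hβ h0
    by_cases h1 : β (vtx 1) ∈ p.badSet 0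
    · have hex : ∃ β', P (β (vtx 1)) β' := ⟨β, hβ, h0, rfl, h1⟩
      rw [hk, dif_pos hex]
      obtain ⟨hβ', h0', h1', -⟩ := hex.choose_spec
      generalize hex.choose = β' at *
      obtain ⟨δ, hδ, rfl, rfl⟩ := hβ.exists_concat_reverse hβ' h0 h0' h1'.symm
      have h01 : (δ.comp (tri (vtx 0) (vtx 1) (midpt (vtx 0) (vtx 1)))).comp
          (seg (vtx 0) (vtx 1)) = δ := by
        rw [comp_affineSimplex_comp_seg, tri_zero, tri_one, comp_seg_vtx]
      have h02 : (δ.comp (tri (vtx 0) (vtx 1) (midpt (vtx 0) (vtx 1)))).comp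
          (seg (vtx 0) (vtx 2)) = δ.comp (seg (vtx 0) (midpt (vtx 0) (vtx 1))) := by
        rw [comp_affineSimplex_comp_seg, tri_zero, tri_two]
      have h12 : (δ.comp (tri (vtx 0) (vtx 1) (midpt (vtx 0) (vtx 1)))).comp
          (seg (vtx 1) (vtx 2)) = δ.comp (seg (vtx 1) (midpt (vtx 0) (vtx 1))) := by
        rw [comp_affineSimplex_comp_seg, tri_one, tri_two]
      -- The degenerate triangle has boundary β' - β + δ, so β = δ + β' minus a boundary, with δ
      -- full and β' the fixed probe.
      refine ⟨gajerChainOf _ ((full_path_iff hF p δ).2 hδ), _, neg_mem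
        (chainOf_triangle_mem hF p (hδ.toIsAllowablePath.comp_affineSimplex
          (v := ![vtx 0, vtx 1, midpt (vtx 0) (vtx 1)]) p.antitone_badSet ⟨0, hδ.zero⟩)
          (h12 ▸ hβ') (h02 ▸ hβ) (h01.symm ▸ hδ.toIsAllowablePath)), ?_⟩
      rw [map_neg, d_chainOf_triangle, gajerToSingular_gajerChainOf, h01, h02, h12]
      abel
    · refine ⟨gajerChainOf _ ((full_path_iff hF p β).2 ⟨hβ, h0, h1⟩), 0, zero_mem _, ?_⟩
      rw [hk, dif_neg fun ⟨β', h⟩ => h1 h.2.2.2, gajerToSingular_gajerChainOf, map_zero, add_zero,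
        add_zero]
  refine ⟨κ, fun ξ hξ => ?_⟩
  refine allowableChains_induction (P := fun ξ => ∃ (r : (gajerChains p).X 1)
    (w : (singularChains X).X 2), w ∈ intersectionChains p 2 ∧ ξ = (gajerToSingular p).f 1 r +
      κ ((singularChains X).d 1 0 ξ) + (singularChains X).d 2 1 w) hξ
    ⟨0, 0, zero_mem _, by simp⟩ ?_ ?_ fun γ hγ => ?_
  · rintro a b ⟨r, w, hw, ha⟩ ⟨r', w', hw', hb⟩
    refine ⟨r + r', w + w', add_mem hw hw', ?_⟩
    simp only [map_add]
    nth_rewrite 1 [ha, hb]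
    abel
  · rintro a ⟨r, w, hw, ha⟩
    refine ⟨-r, -w, neg_mem hw, ?_⟩
    simp only [map_neg]
    nth_rewrite 1 [ha]
    abel
  · replace hγ := (p.allowableMap_one_iff hF γ).1 hγ
    obtain ⟨m, hm⟩ := hγ.exists_notMem
    have hp0 : IsAllowablePath p.badSet (γ.comp (seg m (vtx 0))) := hγ.comp_seg (Or.inl hm)
    have hp1 : IsAllowablePath p.badSet (γ.comp (seg m (vtx 1))) := hγ.comp_seg (Or.inl hm)
    obtain ⟨r0, w0, hw0, e0⟩ := hprobe _ hp0 (by simpa using hm)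
    obtain ⟨r1, w1, hw1, e1⟩ := hprobe _ hp1 (by simpa using hm)
    rw [ContinuousMap.comp_apply, seg_one] at e0 e1
    have h01 : (γ.comp (tri m (vtx 0) (vtx 1))).comp (seg (vtx 0) (vtx 1)) =
        γ.comp (seg m (vtx 0)) := by
      rw [comp_affineSimplex_comp_seg, tri_zero, tri_one]
    have h02 : (γ.comp (tri m (vtx 0) (vtx 1))).comp (seg (vtx 0) (vtx 2)) =
        γ.comp (seg m (vtx 1)) := by
      rw [comp_affineSimplex_comp_seg, tri_zero, tri_two]
    have h12 : (γ.comp (tri m (vtx 0) (vtx 1))).comp (seg (vtx 1) (vtx 2)) = γ := by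
      rw [comp_affineSimplex_comp_seg, tri_one, tri_two, comp_seg_vtx]
    have hmem := chainOf_triangle_mem hF p (hγ.comp_affineSimplex
      (v := ![m, vtx 0, vtx 1]) p.antitone_badSet ⟨0, hm⟩)
      (h12.symm ▸ hγ) (h02.symm ▸ hp1) (h01.symm ▸ hp0)
    have hd := d_chainOf_triangle (γ.comp (tri m (vtx 0) (vtx 1)))
    rw [h01, h02, h12, e0, e1] at hd
    -- The degenerate triangle m, 0, 1 has all edges allowable and expresses γ, up to its boundary,
    -- as the probe to the end minus the probe to the start.
    refine ⟨r1 - r0, _, add_mem (sub_mem hw1 hw0) hmem, ?_⟩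
    rw [d_chainOf_path, map_sub, map_sub, map_add, map_sub, hκ, hκ, hd]
    abel

end Comparison

theorem theorem5 {X : Type u} [TopologicalSpace X] {n : ℕ} (F : FilteredSpace X n)
    (hF : F.LocallyFiniteStratification) (p : Perversity F) :
    IsIso (HomologicalComplex.homologyMap (gajerInclusion p) 0) ∧
      IsIso (HomologicalComplex.homologyMap (gajerInclusion p) 1) := by
  constructor
  · refine isIso_homologyMap_of_elements 0 (gajerInclusion p) (fun z w h => ?_) fun z _ => ?_
    · exact exists_d_eq_of_degree_zero hF p z w.2.1 (congrArg Subtype.val h)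
    · obtain ⟨z', hz'⟩ := exists_gajerToSingular_eq p z.2.1
      refine ⟨z', 0, fun j => ?_, ?_⟩
      · rw [(gajerChains p).shape 0 j (by
          change ¬ j + 1 = 0
          omega)]
        rfl
      · rw [map_zero, add_zero]
        exact Subtype.ext hz'.symm
  · refine isIso_homologyMap_of_elements 1 (gajerInclusion p) (fun z w h => ?_) fun z hz => ?_
    · exact exists_d_eq_of_degree_one hF p z w.2.1 (congrArg Subtype.val h)
    · obtain ⟨κ, hκ⟩ := exists_allowable_decomposition hF p
      obtain ⟨r, w, hw, h⟩ := hκ z.1 z.2.1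
      have hdz : ∀ j, (singularChains X).d 1 j z.1 = 0 := fun j => congrArg Subtype.val (hz j)
      -- For a cycle the term that depends on end points disappears.
      rw [hdz 0, map_zero, add_zero] at h
      refine ⟨r, ⟨w, hw⟩, fun j => ?_, Subtype.ext h⟩
      -- The full part is itself a cycle, as it differs from a cycle by a boundary and the inclusion
      -- of chains is injective.
      apply gajerToSingular_injective
      have := congrArg ((singularChains X).d 1 j) h
      rw [hdz j, map_add, d_d_apply, add_zero, d_gajerToSingular] at this
      rw [← this, map_zero]
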